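/- Let $n\ge 0$ and let $B_n$ be the group of signed permutations, i.e. permutations $\pi$ of $\{-n,\dots,-1,0,1,\dots,n\}$ with $\pi(-i)=-\pi(i)$ for all $i$. Put $\mathrm{Des}(\pi)=\{0\le i\le n-1 \mid \pi(i)>\pi(i+1)\}$. For $I\subseteq\{0,1,\dots,n-1\}$ let $$F^B_I=\sum_{\substack{0=i_0\le i_1\le\dots\le i_n\\ j\in I\Rightarrow i_j<i_{j+1}}}x_{i_1}x_{i_2}\cdots x_{i_n}$$ be Chow's type B fundamental quasisymmetric function in the variables $x_0,x_1,x_2,\dots$, and for $\mathcal B\subseteq B_n$ let $\mathcal Q(\mathcal B)=\sum_{\pi\in\mathcal B}F^B_{\mathrm{Des}(\pi)}$. Let $\mathcal P^0(n)$ be the set of partitions of $2n$ whose Young diagram can be tiled by dominoes ($1\times 2$ or $2\times 1$ rectangles). For $\lambda\in\mathcal P^0(n)$, a semistandard domino tableau of shape $\lambda$ is a domino tiling of the Young diagram of $\lambda$ together with a label in $\{0,1,2,\dots\}$ on each domino, such that labels are weakly increasing along rows, strictly increasing down columns (from one domino to another), and the domino covering the top left cell is not labelled $0$ if it is vertical.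 The domino function is $\mathcal G_\lambda=\sum_T\prod_{i\ge0}x_i^{\mu_i(T)}$, summed over all semistandard domino tableaux $T$ of shape $\lambda$, where $\mu_i(T)$ is the number of dominoes of $T$ labelled $i$. A set $\mathcal B\subseteq B_n$ is called $\mathcal G$-positive if $\mathcal Q(\mathcal B)=\sum_{\lambda\in\mathcal P^0(n)}c_\lambda\,\mathcal G_\lambda$ for some non-negative integers $c_\lambda$. A signed permutation $\pi\in B_n$ is left-unimodal if there is $i\in\{1,\dots,n\}$ such that $$\pi^{-1}(1)>\pi^{-1}(2)>\dots>\pi^{-1}(i)<\pi^{-1}(i+1)<\dots<\pi^{-1}(n).$$ **Proposition.** The set of left-unimodal signed permutations in $B_n$ is a union of inverse descent classes $\{\pi\in B_n \mid \mathrm{Des}(\pi^{-1})=J\}$, $J\subseteq\{0,1,\dots,n-1\}$, and it is $\mathcal G$-positive. -/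

import Mathlib

noncomputable section

namespace TypeB

/-- The hyperoctahedral group `B_n`: the permutations `π` of `{-n, …, -1, 0, 1, …, n}` such that
`π (-i) = -π i` for all `i`. -/
def signedPerm (n : ℕ) : Subgroup (Equiv.Perm (Finset.Icc (-(n : ℤ)) (n : ℤ))) where
  carrier := {π | ∀ i j : Finset.Icc (-(n : ℤ)) (n : ℤ),
    (j : ℤ) = -(i : ℤ) → (π j : ℤ) = -(π i : ℤ)}
  mul_mem' := by
    intro a b ha hb i j hij
    exact ha _ _ (hb i j hij)
  one_mem' := by
    intro i j hij
    exact hij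
  inv_mem' := by
    intro a ha i j hij
    have hmem : -((a⁻¹ i : Finset.Icc (-(n : ℤ)) (n : ℤ)) : ℤ) ∈ Finset.Icc (-(n : ℤ)) (n : ℤ) := by
      have h := Finset.mem_Icc.1 (a⁻¹ i).2
      rw [Finset.mem_Icc]
      constructor <;> linarith [h.1, h.2]
    have h1 := ha (a⁻¹ i) ⟨_, hmem⟩ rfl
    have h2 : a ⟨_, hmem⟩ = j := by
      apply Subtype.ext
      rw [h1, hij]
      simp
    rw [← h2]
    simp

/-- The value `π(i)` of a signed permutation, as a function on the integers (the values at
integers outside `{-n, …, n}` are never used). -/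
def signedVal {n : ℕ} (π : signedPerm n) (i : ℤ) : ℤ :=
  if h : i ∈ Finset.Icc (-(n : ℤ)) (n : ℤ) then (π.1 ⟨i, h⟩ : ℤ) else i

/-- The descent set `Des(π) = {0 ≤ i ≤ n - 1 ∣ π(i) > π(i+1)}` (with `π(0) = 0`). -/
def descents {n : ℕ} (π : signedPerm n) : Finset ℕ :=
  (Finset.range n).filter fun i => signedVal π (i : ℤ) > signedVal π ((i : ℤ) + 1)

/-- The inverse descent class `{π ∈ B_n ∣ Des(π⁻¹) = J}`. -/
def inverseDescentClass (n : ℕ) (J : Finset ℕ) : Set (signedPerm n) :=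
  {π | descents π⁻¹ = J}

/-- The left-unimodal signed permutations: for some `1 ≤ i ≤ n`,
`π⁻¹(1) > ⋯ > π⁻¹(i) < π⁻¹(i+1) < ⋯ < π⁻¹(n)`. -/
def leftUnimodal (n : ℕ) : Set (signedPerm n) :=
  {π | ∃ i : ℕ, 1 ≤ i ∧ i ≤ n ∧
    (∀ j : ℕ, 1 ≤ j → j < i → signedVal π⁻¹ (j : ℤ) > signedVal π⁻¹ ((j : ℤ) + 1)) ∧
    (∀ j : ℕ, i ≤ j → j < n → signedVal π⁻¹ (j : ℤ) < signedVal π⁻¹ ((j : ℤ) + 1))}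

/-- The index sequences `0 = i_0 ≤ i_1 ≤ ⋯ ≤ i_n` with `i_j < i_{j+1}` for `j ∈ I` whose monomial
`x_{i_1} ⋯ x_{i_n}` is `x^m`. -/
def chowSequences (n : ℕ) (I : Finset ℕ) (m : ℕ →₀ ℕ) : Set (Fin (n + 1) → ℕ) :=
  {i | i 0 = 0 ∧ Monotone i ∧ (∀ j : Fin n, (j : ℕ) ∈ I → i j.castSucc < i j.succ) ∧
    ∑ j : Fin n, Finsupp.single (i j.succ) 1 = m}

/-- Chow's type B fundamental quasisymmetric function `F^B_I` of degree `n`, as a formal power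
series in `x_0, x_1, x_2, …`, given by its coefficients. -/
def chowF (n : ℕ) (I : Finset ℕ) : MvPowerSeries ℕ ℂ :=
  fun m => ((chowSequences n I m).ncard : ℂ)

/-- The type B quasisymmetric function `Q(𝓑) = ∑_{π ∈ 𝓑} F^B_{Des(π)}` of a set of signed
permutations. -/
def quasisymm {n : ℕ} (B : Set (signedPerm n)) : MvPowerSeries ℕ ℂ :=
  ∑ π ∈ B.toFinite.toFinset, chowF n (descents π)

/-- A domino: two horizontally or vertically adjacent cells (row, column). -/
def IsDomino (d : Finset (ℕ × ℕ)) : Prop :=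
  ∃ i j : ℕ, d = {(i, j), (i, j + 1)} ∨ d = {(i, j), (i + 1, j)}

/-- `D` is a tiling of the Young diagram of `μ` by dominoes. -/
def IsDominoTiling (μ : YoungDiagram) (D : Finset (Finset (ℕ × ℕ))) : Prop :=
  (∀ d ∈ D, IsDomino d ∧ d ⊆ μ.cells) ∧ ∀ c ∈ μ.cells, ∃! d, d ∈ D ∧ c ∈ d

/-- `𝓟⁰(n)`: the partitions of `2n` (as Young diagrams) that can be tiled by dominoes, that is,
have empty `2`-core. -/
def emptyTwoCore (n : ℕ) : Set YoungDiagram :=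
  {μ | μ.card = 2 * n ∧ ∃ D, IsDominoTiling μ D}

/-- Semistandard domino tableaux of shape `μ`. Such a tableau is a finite set `T` of labelled
dominoes `(d, a)` that tile the diagram: labels weakly increase along rows, strictly increase down
columns (from one domino to another), and a vertical domino in the top left corner is not
labelled `0`. -/
structure IsSSDT (μ : YoungDiagram) (T : Finset (Finset (ℕ × ℕ) × ℕ)) : Prop where
  domino : ∀ p ∈ T, IsDomino p.1 ∧ p.1 ⊆ μ.cells
  cover : ∀ c ∈ μ.cells, ∃! p, p ∈ T ∧ c ∈ p.1
  row_weak : ∀ p ∈ T, ∀ q ∈ T, ∀ i j j' : ℕ,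
    (i, j) ∈ p.1 → (i, j') ∈ q.1 → j < j' → p.2 ≤ q.2
  col_strict : ∀ p ∈ T, ∀ q ∈ T, p ≠ q → ∀ i i' j : ℕ,
    (i, j) ∈ p.1 → (i', j) ∈ q.1 → i < i' → p.2 < q.2
  corner : ∀ a : ℕ, ((({(0, 0), (1, 0)} : Finset (ℕ × ℕ)), a) ∈ T) → a ≠ 0

/-- The weight `(μ_0, μ_1, …)` of a tableau: `μ_a` dominoes are labelled `a`. -/
def tableauWeight (T : Finset (Finset (ℕ × ℕ) × ℕ)) : ℕ →₀ ℕ :=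
  ∑ p ∈ T, Finsupp.single p.2 1

/-- The domino function `𝓖_μ = ∑_T X^T` over the semistandard domino tableaux of shape `μ`, as a
formal power series in `x_0, x_1, x_2, …`, given by its coefficients. -/
def dominoFunction (μ : YoungDiagram) : MvPowerSeries ℕ ℂ :=
  fun m => (({T | IsSSDT μ T ∧ tableauWeight T = m}.ncard : ℕ) : ℂ)

/-- `𝓑 ⊆ B_n` is `𝓖`-positive (type B Schur positive): `Q(𝓑)` is a sum of domino functions of
shapes in `𝓟⁰(n)` with non-negative (integer) coefficients. -/
def IsGPositive {n : ℕ} (B : Set (signedPerm n)) : Prop :=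
  ∃ c : YoungDiagram →₀ ℕ, (∀ μ ∈ c.support, μ ∈ emptyTwoCore n) ∧
    quasisymm B = c.sum fun μ k => k • dominoFunction μ

/-- The set whose size is the coefficient of `F^B_I` is finite. -/
theorem chowSequences_finite (n : ℕ) (I : Finset ℕ) (m : ℕ →₀ ℕ) :
    (chowSequences n I m).Finite := by
  apply Set.Finite.subset
    (Set.Finite.pi' (ι := Fin (n + 1)) (t := fun _ => ((insert 0 m.support : Finset ℕ) : Set ℕ))
      (fun _ => Finset.finite_toSet _))
  rintro i ⟨h0, -, -, hm⟩ j
  refine Fin.cases ?_ (fun k => ?_) j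
  · simp [h0]
  · have h : m (i k.succ) ≠ 0 := by
      rw [← hm, Finsupp.finsetSum_apply]
      apply ne_of_gt
      refine lt_of_lt_of_le ?_ (Finset.single_le_sum (fun _ _ => Nat.zero_le _) (Finset.mem_univ k))
      simp
    simp only [Finset.coe_insert, Set.mem_insert_iff, Finset.mem_coe, Finsupp.mem_support_iff]
    exact Or.inr h

/-- The set whose size is the coefficient of `𝓖_μ` is finite. -/
theorem ssdt_finite (μ : YoungDiagram) (m : ℕ →₀ ℕ) :
    {T | IsSSDT μ T ∧ tableauWeight T = m}.Finite := by
  apply Set.Finite.subset (Finset.finite_toSet (μ.cells.powerset ×ˢ m.support).powerset)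
  rintro T ⟨hT, hm⟩
  simp only [Finset.mem_coe, Finset.mem_powerset]
  intro p hp
  rw [Finset.mem_product, Finset.mem_powerset, Finsupp.mem_support_iff]
  refine ⟨(hT.domino p hp).2, ?_⟩
  rw [← hm, tableauWeight, Finsupp.finsetSum_apply]
  apply ne_of_gt
  refine lt_of_lt_of_le ?_ (Finset.single_le_sum (fun _ _ => Nat.zero_le _) hp)
  simp

end TypeB

end

/-! Both sides are compared monomial by monomial, after doubling. For a monomial m of degree n ≥ 1
with exponents m_a, twice the coefficient turns out to be the product over the occurring a of 2 (if
a = 0) or 4·m_a (if a > 0); this number is `unimodalCoeff m`.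

Permutation side. Exactly one weakly increasing sequence i has monomial m, so the coefficient in Q
counts the left-unimodal π with no descent where i stalls. In π⁻¹(1)⋯π⁻¹(n) the valley letter may be
assigned to the decreasing or to the increasing part, so each π comes with exactly two cut points l.
A pair (π, l) is the same as an arbitrary sequence of marks on 1, …, n: the sign of π(k), and
whether |π(k)| ≤ l. Whether k is a descent depends only on two consecutive marks
(`notMem_descents_succ`), so the count is a transfer-matrix computation which factors over the runs
of constant i (`card_markSeqs`).

Domino side. The shapes used are those whose 2-quotient is a pair of possibly empty hooks, weighted
by 2 to the number of nonempty hooks. The dominoes with the largest label form a horizontal domino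
strip. Such a strip has only one tiling, and it corresponds to one horizontal strip on each
component of the quotient (`stripRows_quotientShape_iff`). A hook extends by k > 0 cells in two ways
(the empty hook in one, doubling the weight), so each component receiving cells contributes a factor
2; over all splittings of m_a between the two components this gives 4·m_a (`sum_hookPairs_strip`).
For the label 0 the corner condition leaves a single row only, of weight 2. Induction on the largest
label gives the same product (`sum_hookWeight_mul_card_ssdts`).

Halving, a shape occurs with multiplicity 1 or 2 according to the number of nonempty hooks. The
description by inverse descent classes is immediate: unimodality of π⁻¹ only speaks of its descents.
-/

namespace TypeB

/-! ### Row lengths of shapes with hook quotients and of domino strips -/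

/-- The row lengths of the Young diagram with first two rows `r₀, r₁`, first two columns `c₀, c₁`
and no further cells outside these. -/
def doubleHookRows (r₀ r₁ c₀ c₁ i : ℕ) : ℕ :=
  if i = 0 then r₀ else if i = 1 then r₁ else if i < c₁ then 2 else if i < c₀ then 1 else 0

/-- A pair of possibly empty hooks, each given by its arm and leg lengths. -/
abbrev HookPair := Option (ℕ × ℕ) × Option (ℕ × ℕ)

/-- The row lengths of the partition with empty `2`-core whose `2`-quotient is a pair of hooks. -/
def quotientRows : HookPair → ℕ → ℕ
  | (none, none) => doubleHookRows 0 0 0 0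
  | (some (a, b), none) => doubleHookRows (2 * a + 1) 1 (2 * b + 2) 0
  | (none, some (a, b)) => doubleHookRows (2 * a + 2) (min b 1) (2 * b + 1) 0
  -- In Frobenius coordinates a hook in the first component contributes the arm 2a and the leg 2b +
  -- 1, one in the second the arm 2c + 1 and the leg 2d. With two hooks the arms and the legs are
  -- sorted separately; the parities still tell which component each belongs to.
  | (some (a, b), some (c, d)) =>
      doubleHookRows (max (2 * a) (2 * c + 1) + 1) (min (2 * a) (2 * c + 1) + 2)
        (max (2 * b + 1) (2 * d) + 1) (min (2 * b + 1) (2 * d) + 2)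

/-- Arithmetic conditions on row lengths for the skew shape to be a horizontal domino strip. -/
def StripRows (x y : ℕ → ℕ) : Prop :=
  -- The last two conditions count, row by row, the columns whose only new cell lies in that row;
  -- these have to be paired by horizontal dominoes. Truncated subtraction gives 0 when there are
  -- none.
  (∀ i, x i ≤ y i) ∧ (∀ i, y (i + 2) ≤ x i) ∧ Even (y 0 - max (x 0) (y 1)) ∧
    ∀ i, Even (min (y (i + 1)) (x i) - max (x (i + 1)) (y (i + 2)))

/-- The hook `q` arises from the hook `p` by adding a horizontal strip. -/
def HookStrip : Option (ℕ × ℕ) → Option (ℕ × ℕ) → Prop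
  | none, none => True
  | none, some q => q.2 = 0
  | some _, none => False
  | some p, some q => p.1 ≤ q.1 ∧ (q.2 = p.2 ∨ q.2 = p.2 + 1)

theorem antitone_quotientRows (p : HookPair) : Antitone (quotientRows p) := by
  have h : ∀ i, quotientRows p (i + 1) ≤ quotientRows p i := by
    intro i
    rcases p with ⟨_ | ⟨a, b⟩, _ | ⟨c, d⟩⟩ <;> rcases i with _ | _ | i <;>
      simp [quotientRows, doubleHookRows] <;> (try split_ifs) <;> omega
  exact antitone_nat_of_succ_le h

set_option maxHeartbeats 4000000 in
theorem stripRows_of_hookStrip {p q : HookPair} (h₁ : HookStrip p.1 q.1)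
    (h₂ : HookStrip p.2 q.2) : StripRows (quotientRows p) (quotientRows q) := by
  rcases p with ⟨_ | ⟨a, b⟩, _ | ⟨c, d⟩⟩ <;> rcases q with ⟨_ | ⟨a', b'⟩, _ | ⟨c', d'⟩⟩ <;>
  simp only [HookStrip] at h₁ h₂ <;>
  refine ⟨fun i => ?_, fun i => ?_, ?_, fun i => ?_⟩ <;> (try rcases i with _ | _ | i) <;>
    simp [quotientRows, doubleHookRows, Nat.even_iff] <;> (try split_ifs) <;> omega

end TypeB

/-! ### Removing a domino strip stays among hook quotients -/

namespace TypeB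

theorem doubleHookRows_zero (r₀ r₁ c₀ c₁ : ℕ) : doubleHookRows r₀ r₁ c₀ c₁ 0 = r₀ := by
  simp [doubleHookRows]

theorem doubleHookRows_one (r₀ r₁ c₀ c₁ : ℕ) : doubleHookRows r₀ r₁ c₀ c₁ 1 = r₁ := by
  simp [doubleHookRows]

theorem doubleHookRows_add_two (r₀ r₁ c₀ c₁ i : ℕ) : doubleHookRows r₀ r₁ c₀ c₁ (i + 2) =
    if i + 2 < c₁ then 2 else if i + 2 < c₀ then 1 else 0 := by
  simp [doubleHookRows]

theorem doubleHookRows_add_two_le (r₀ r₁ c₀ c₁ i : ℕ) :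
    doubleHookRows r₀ r₁ c₀ c₁ (i + 2) ≤ 2 := by
  rw [doubleHookRows_add_two]
  split_ifs <;> omega

theorem eq_doubleHookRows {x : ℕ → ℕ} {d₀ d₁ : ℕ} (h₀ : ∀ i, i < d₀ ↔ 1 ≤ x i)
    (h₁ : ∀ i, i < d₁ ↔ 2 ≤ x i) (h2 : ∀ i, x (i + 2) ≤ 2) :
    x = doubleHookRows (x 0) (x 1) d₀ d₁ := by
  funext i
  rcases i with _ | _ | i
  · simp [doubleHookRows]
  · simp [doubleHookRows]
  · have := h2 i
    have := h₀ (i + 2)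
    have := h₁ (i + 2)
    change x (i + 2) = doubleHookRows _ _ _ _ (i + 2)
    rw [doubleHookRows_add_two]
    split_ifs <;> omega

/-- Constraints on the lengths of the first two columns of the two shapes of a domino strip. -/
structure HookBounds (d₀ d₁ C₀ C₁ : ℕ) : Prop where
  d0_le : d₀ ≤ C₀
  d1_le : d₁ ≤ C₁
  le_d0 : C₀ ≤ d₀ + 2
  le_d1 : C₁ ≤ d₁ + 2
  single0 : 2 ≤ d₀ → C₀ = d₀ + 1 → d₁ = d₀ ∧ C₁ = C₀
  single1 : 2 ≤ d₁ → C₁ = d₁ + 1 → d₁ = d₀ ∧ C₁ = C₀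

/-- A column of a domino strip has at most two new cells. If the first or second column gains
exactly one cell, in a row of index at least 2, that cell needs a horizontal domino; as such rows
have length at most 2, the domino fills columns 0 and 1, so both columns had the same length and
grow together. -/
theorem hookBounds {x y : ℕ → ℕ} (hy : Antitone y) {d₀ d₁ C₀ C₁ : ℕ}
    (hd₀ : ∀ i, i < d₀ ↔ 1 ≤ x i)
    (hd₁ : ∀ i, i < d₁ ↔ 2 ≤ x i) (hC₀ : ∀ i, i < C₀ ↔ 1 ≤ y i)
    (hC₁ : ∀ i, i < C₁ ↔ 2 ≤ y i) (hy2 : y 2 ≤ 2) (h : StripRows x y) :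
    HookBounds d₀ d₁ C₀ C₁ := by
  obtain ⟨hle, hle2, -, hev⟩ := h
  have h1 : d₀ ≤ C₀ := by
    by_contra hc
    have := (hd₀ C₀).1 (by omega)
    have := hC₀ C₀
    have := hle C₀
    omega
  have h2 : d₁ ≤ C₁ := by
    by_contra hc
    have := (hd₁ C₁).1 (by omega)
    have := hC₁ C₁
    have := hle C₁
    omega
  refine ⟨h1, h2, ?_, ?_, ?_, ?_⟩
  · have := hd₀ d₀
    have := hC₀ (d₀ + 2)
    have := hle2 d₀
    omega
  · have := hd₁ d₁
    have := hC₁ (d₁ + 2)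
    have := hle2 d₁
    omega
  · intro hd hC
    obtain ⟨k, rfl⟩ : ∃ k, d₀ = k + 2 := ⟨d₀ - 2, by omega⟩
    have e1 := hev (k + 1)
    rw [Nat.even_iff] at e1
    have := hd₀ (k + 1)
    have := hd₀ (k + 2)
    have := hd₁ (k + 1)
    have := hd₁ (k + 2)
    have := hC₀ (k + 2)
    have := hC₀ (k + 3)
    have := hC₁ (k + 2)
    have := hC₁ (k + 3)
    have : y (k + 2) ≤ 2 := (hy (by omega)).trans hy2
    have := hle (k + 2)
    simp only [Nat.add_assoc, Nat.reduceAdd] at *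
    omega
  · intro hd hC
    obtain ⟨k, rfl⟩ : ∃ k, d₁ = k + 2 := ⟨d₁ - 2, by omega⟩
    have e1 := hev (k + 1)
    rw [Nat.even_iff] at e1
    have := hd₀ (k + 1)
    have := hd₀ (k + 2)
    have := hd₁ (k + 1)
    have := hd₁ (k + 2)
    have := hC₀ (k + 2)
    have := hC₀ (k + 3)
    have := hC₁ (k + 2)
    have := hC₁ (k + 3)
    have : y (k + 2) ≤ 2 := (hy (by omega)).trans hy2
    have := hle (k + 2)
    simp only [Nat.add_assoc, Nat.reduceAdd] at *
    omega

/-- Rows 0 and 1 are recorded separately, so a second column of length at most 2 leaves no trace.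
This reconciles true column lengths with the value 0 used for single hooks. -/
theorem doubleHookRows_congr {r₀ r₁ c₀ c₁ c₁' : ℕ} (h : c₁ = c₁' ∨ c₁ ≤ 2 ∧ c₁' ≤ 2) :
    doubleHookRows r₀ r₁ c₀ c₁ = doubleHookRows r₀ r₁ c₀ c₁' := by
  funext i
  rcases i with _ | _ | i
  · simp [doubleHookRows]
  · simp [doubleHookRows]
  · change doubleHookRows _ _ _ _ (i + 2) = doubleHookRows _ _ _ _ (i + 2)
    rw [doubleHookRows_add_two, doubleHookRows_add_two]
    split_ifs <;> omega


/-- Case where both shapes contain the cell (1, 1). The strip conditions force the two arms of x to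
have opposite parities, and likewise its two legs. The even arm and the odd leg belong to the first
component, the others to the second. -/
theorem exists_quotientRows_of_two_le {x y : ℕ → ℕ} (hx : Antitone x) {d₀ d₁ C₀ C₁ : ℕ}
    (hd₀ : ∀ i, i < d₀ ↔ 1 ≤ x i) (hd₁ : ∀ i, i < d₁ ↔ 2 ≤ x i)
    (hb : HookBounds d₀ d₁ C₀ C₁) (h : StripRows x y) {a b c d : ℕ}
    (hy : y = doubleHookRows (max (2 * a) (2 * c + 1) + 1) (min (2 * a) (2 * c + 1) + 2) C₀ C₁)
    (hC₀ : C₀ = max (2 * b + 1) (2 * d) + 1) (hC₁ : C₁ = min (2 * b + 1) (2 * d) + 2)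
    (hx1 : 2 ≤ x 1) :
    ∃ p, x = quotientRows p ∧ HookStrip p.1 (some (a, b)) ∧ HookStrip p.2 (some (c, d)) := by
  have y2 : y 2 ≤ 2 := by rw [hy]; exact doubleHookRows_add_two_le _ _ _ _ 0
  have h2 : ∀ i, x (i + 2) ≤ 2 := fun i => (hx (by omega)).trans ((h.1 2).trans y2)
  have hd01 : d₁ ≤ d₀ := by
    by_contra hc
    have := (hd₁ d₀).1 (by omega)
    have := hd₀ d₀
    omega
  have hd1 : 2 ≤ d₁ := (hd₁ 1).2 hx1
  have dar : (d₀ + d₁) % 2 = 0 := by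
    have hC : (C₀ + C₁) % 2 = 0 := by omega
    obtain ⟨b1, b2, b3, b4, b5, b6⟩ := hb
    clear hC₀ hC₁
    omega
  have hcol : if d₀ % 2 = 0 then
      (2 * b + 2 = d₀ ∨ 2 * b + 2 = d₀ + 2) ∧ (2 * d + 2 = d₁ ∨ 2 * d + 2 = d₁ + 2)
      else (2 * d + 1 = d₀ ∨ 2 * d + 1 = d₀ + 2) ∧ (2 * b + 3 = d₁ ∨ 2 * b + 3 = d₁ + 2) := by
    obtain ⟨b1, b2, b3, b4, b5, b6⟩ := hb
    rcases le_total (2 * b + 1) (2 * d) with hbd | hbd <;> split_ifs <;>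
      simp only [hbd, max_eq_left, max_eq_right, min_eq_left, min_eq_right] at hC₀ hC₁ <;> omega
  have hrow : (x 0 + x 1) % 2 = 0 ∧ x 1 ≤ x 0 ∧ if x 0 % 2 = 1 then
      x 0 ≤ 2 * a + 1 ∧ x 1 ≤ 2 * c + 3 else x 1 ≤ 2 * a + 2 ∧ x 0 ≤ 2 * c + 2 := by
    have y0 : y 0 = max (2 * a) (2 * c + 1) + 1 := by rw [hy, doubleHookRows_zero]
    have y1 : y 1 = min (2 * a) (2 * c + 1) + 2 := by rw [hy, doubleHookRows_one]
    obtain ⟨hle, -, hev0, hev⟩ := h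
    have e0 := hle 0
    have e1 := hle 1
    have hev1 := hev 0
    simp only [zero_add] at hev1
    rw [Nat.even_iff] at hev0 hev1
    have hx01 : x 1 ≤ x 0 := hx (by omega)
    clear hb hC₀ hC₁ hcol dar hd01 hd1
    have par : (x 0 + x 1) % 2 = 0 := by omega
    refine ⟨par, hx01, ?_⟩
    split_ifs <;> omega
  clear hb
  rw [eq_doubleHookRows hd₀ hd₁ h2]
  -- The arms of x are x 0 - 1 and x 1 - 2, its legs d₀ - 1 and d₁ - 2; the parities of x 0 and d₀
  -- decide which of them goes to which component.
  refine ⟨(some (if x 0 % 2 = 1 then (x 0 - 1) / 2 else (x 1 - 2) / 2,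
      if d₀ % 2 = 0 then (d₀ - 2) / 2 else (d₁ - 3) / 2),
    some (if x 0 % 2 = 1 then (x 1 - 3) / 2 else (x 0 - 2) / 2,
      if d₀ % 2 = 0 then (d₁ - 2) / 2 else (d₀ - 1) / 2)), ?_, ?_⟩
  · simp only [quotientRows]
    clear hC₀ hC₁ hcol
    congr 1 <;> split_ifs <;> omega
  · simp only [HookStrip]
    clear hC₀ hC₁ y2
    obtain ⟨-, -, hrow⟩ := hrow
    refine ⟨⟨?_, ?_⟩, ?_, ?_⟩
    · clear hcol dar; split_ifs at hrow ⊢ <;> omega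
    · clear hrow; split_ifs at hcol ⊢ <;> omega
    · clear hcol dar; split_ifs at hrow ⊢ <;> omega
    · clear hrow; split_ifs at hcol ⊢ <;> omega

/-- Case where the larger shape has two hooks and the smaller one is empty or a single hook, whose
component is read off from the parity of x 0. -/
theorem exists_quotientRows_hook {x y : ℕ → ℕ} (hx : Antitone x) {d₀ d₁ C₀ C₁ : ℕ}
    (hd₀ : ∀ i, i < d₀ ↔ 1 ≤ x i) (hd₁ : ∀ i, i < d₁ ↔ 2 ≤ x i)
    (hyC₀ : ∀ i, i < C₀ ↔ 1 ≤ y i) (hyC₁ : ∀ i, i < C₁ ↔ 2 ≤ y i)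
    (hb : HookBounds d₀ d₁ C₀ C₁) (h : StripRows x y) {a b c d : ℕ}
    (hy : y = doubleHookRows (max (2 * a) (2 * c + 1) + 1) (min (2 * a) (2 * c + 1) + 2) C₀ C₁)
    (hC₀ : C₀ = max (2 * b + 1) (2 * d) + 1) (hC₁ : C₁ = min (2 * b + 1) (2 * d) + 2)
    (hx1 : x 1 < 2) :
    ∃ p, x = quotientRows p ∧ HookStrip p.1 (some (a, b)) ∧ HookStrip p.2 (some (c, d)) := by
  have y2 : y 2 ≤ 2 := by rw [hy]; exact doubleHookRows_add_two_le _ _ _ _ 0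
  have h2 : ∀ i, x (i + 2) ≤ 2 := fun i => (hx (by omega)).trans ((h.1 2).trans y2)
  have f0 := hd₀ 0
  have f1 := hd₀ 1
  have g0 := hd₁ 0
  have g1 := hd₁ 1
  have hC : (C₀ + C₁) % 2 = 0 ∧ 2 ≤ C₁ ∧ C₁ ≤ C₀ := by omega
  obtain ⟨hCe, hC2, hC01⟩ := hC
  rcases Nat.eq_zero_or_pos (x 0) with hx0 | hx0
  · refine ⟨(none, none), ?_, ?_⟩
    · funext i
      have : x i ≤ x 0 := hx (by omega)
      have : quotientRows (none, none) i = 0 := by simp [quotientRows, doubleHookRows]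
      omega
    · have := hb.le_d0
      simp only [HookStrip]
      omega
  -- Since y 0 + y 1 is even, adding the parity conditions of rows 0 and 1 gives x 0 ≡ max (x 1) (y
  -- 2) mod 2. Hence x 0 and d₀ have opposite parities, as required of a hook with empty 2-core.
  have hM : max (x 1) (y 2) % 2 = (d₀ + 1) % 2 ∧ max (x 1) (y 2) ≤ x 0 := by
    have F2 := hyC₀ 2
    have G2 := hyC₁ 2
    obtain ⟨b1, b2, b3, b4, b5, b6⟩ := hb
    clear hC₀ hC₁
    have : C₁ = 2 ∨ C₁ = 3 := by omega
    rcases this with rfl | rfl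
    · have : d₀ = 1 ∨ 2 ≤ d₀ := by omega
      rcases this with rfl | hd <;> omega
    · have : d₀ = 1 ∨ 2 ≤ d₀ := by omega
      rcases this with rfl | hd <;> omega
  have hrow : (x 0 + d₀) % 2 = 1 ∧
      if x 0 % 2 = 0 then x 0 ≤ 2 * c + 2 else x 0 ≤ 2 * a + 1 := by
    have y0 : y 0 = max (2 * a) (2 * c + 1) + 1 := by rw [hy, doubleHookRows_zero]
    have y1 : y 1 = min (2 * a) (2 * c + 1) + 2 := by rw [hy, doubleHookRows_one]
    obtain ⟨hle, -, hev0, hev⟩ := h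
    have e0 := hle 0
    have hev1 := hev 0
    simp only [zero_add] at hev1
    rw [Nat.even_iff] at hev0 hev1
    have hM2 : max (x 1) (y 2) ≤ 2 := by omega
    generalize max (x 1) (y 2) = M at hM hev1 hM2
    clear hb hC₀ hC₁ f0 f1 g0 g1 hCe hC2 hC01
    have par : (x 0 + d₀) % 2 = 1 := by omega
    refine ⟨par, ?_⟩
    clear hev1 hM
    split_ifs <;> omega
  clear hM
  obtain ⟨par, hrow⟩ := hrow
  have hcol : if d₀ % 2 = 1 then b = 0 ∧ (2 * d + 1 = d₀ ∨ 2 * d + 1 = d₀ + 2)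
      else d = 0 ∧ (2 * b + 2 = d₀ ∨ 2 * b + 2 = d₀ + 2) := by
    obtain ⟨b1, b2, b3, b4, b5, b6⟩ := hb
    clear hrow par
    rcases le_total (2 * b + 1) (2 * d) with hbd | hbd <;> split_ifs <;>
      simp only [hbd, max_eq_left, max_eq_right, min_eq_left, min_eq_right] at hC₀ hC₁ <;> omega
  rw [eq_doubleHookRows hd₀ hd₁ h2, doubleHookRows_congr (c₁' := 0) (by omega)]
  clear hb hC₀ hC₁
  rcases Nat.mod_two_eq_zero_or_one (x 0) with hp | hp
  · rw [if_pos hp] at hrow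
    rw [if_pos (by omega)] at hcol
    refine ⟨(none, some ((x 0 - 2) / 2, (d₀ - 1) / 2)), ?_, ?_, ?_⟩
    · simp only [quotientRows]
      congr 1 <;> omega
    · simp only [HookStrip]
      omega
    · simp only [HookStrip]
      omega
  · rw [if_neg (by omega)] at hrow hcol
    refine ⟨(some ((x 0 - 1) / 2, (d₀ - 2) / 2), none), ?_, ?_, ?_⟩
    · simp only [quotientRows]
      congr 1 <;> omega
    · simp only [HookStrip]
      omega
    · simp only [HookStrip]
      omega

theorem exists_quotientRows_of_hook {x y : ℕ → ℕ} (hx : Antitone x) {d₀ d₁ C₀ C₁ : ℕ}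
    (hd₀ : ∀ i, i < d₀ ↔ 1 ≤ x i) (hd₁ : ∀ i, i < d₁ ↔ 2 ≤ x i)
    (hC₀ : ∀ i, i < C₀ ↔ 1 ≤ y i)
    (hb : HookBounds d₀ d₁ C₀ C₁) (h : StripRows x y) (hy : y 1 ≤ 1)
    (hpar : (y 0 + C₀) % 2 = 1) :
    ∃ p, x = quotientRows p ∧
      HookStrip p.1 (if y 0 % 2 = 1 then some ((y 0 - 1) / 2, (C₀ - 2) / 2) else none) ∧
      HookStrip p.2 (if y 0 % 2 = 0 then some ((y 0 - 2) / 2, (C₀ - 1) / 2) else none) := by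
  obtain ⟨hle, -, hev0, hev⟩ := h
  have h2 : ∀ i, x (i + 2) ≤ 2 := fun i =>
    (hx (by omega)).trans ((hle 1).trans (hy.trans (by omega)))
  have hx01 : x 1 ≤ x 0 := hx (by omega)
  have e0 := hle 0
  have e1 := hle 1
  have hev1 := hev 0
  simp only [zero_add] at hev1
  rw [Nat.even_iff] at hev0 hev1
  obtain ⟨b1, b2, b3, b4, b5, -⟩ := hb
  have f0 := hd₀ 0
  have f1 := hd₀ 1
  have g1 := hd₁ 1
  have F0 := hC₀ 0
  have F1 := hC₀ 1
  have F2 := hC₀ 2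
  rcases Nat.eq_zero_or_pos (x 0) with hx0 | hx0
  · clear hev1 hev0
    refine ⟨(none, none), ?_, ?_, ?_⟩
    · funext i
      have : x i ≤ x 0 := hx (by omega)
      have : quotientRows (none, none) i = 0 := by simp [quotientRows, doubleHookRows]
      omega
    all_goals
      split_ifs
      · simp only [HookStrip]
        omega
      · trivial
  have p1 : (x 0 + y 0) % 2 = 0 := by
    rw [max_eq_left (by omega)] at hev0
    omega
  -- Growth by one would force x to be a single row and (1, 0) to be the only new cell of row 1,
  -- below a cell of x, which no domino could cover.
  have p2 : C₀ = d₀ ∨ C₀ = d₀ + 2 := by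
    clear hev0 hpar
    by_contra hc
    have h3 : C₀ = d₀ + 1 := by omega
    have h4 : d₀ = 1 := by omega
    have h5 : x 1 = 0 := by omega
    have h6 : y 1 = 1 := by omega
    have h7 : y 2 = 0 := by omega
    rw [h5, h6, h7, min_eq_left (by omega)] at hev1
    simp at hev1
  clear hev1 hev0
  rw [eq_doubleHookRows hd₀ hd₁ h2, doubleHookRows_congr (c₁' := 0) (by omega)]
  rcases Nat.mod_two_eq_zero_or_one (x 0) with hp | hp
  · refine ⟨(none, some ((x 0 - 2) / 2, (d₀ - 1) / 2)), ?_, ?_, ?_⟩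
    · simp only [quotientRows]
      congr 1 <;> omega
    · rw [if_neg (by omega)]
      trivial
    · rw [if_pos (by omega)]
      simp only [HookStrip]
      omega
  · refine ⟨(some ((x 0 - 1) / 2, (d₀ - 2) / 2), none), ?_, ?_, ?_⟩
    · simp only [quotientRows]
      congr 1 <;> omega
    · rw [if_pos (by omega)]
      simp only [HookStrip]
      omega
    · rw [if_neg (by omega)]
      trivial

/-- The length of the first column of a partition given by `quotientRows`. -/
def quotientCol₀ : HookPair → ℕ
  | (none, none) => 0
  | (some (_, b), none) => 2 * b + 2
  | (none, some (_, b)) => 2 * b + 1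
  | (some (_, b), some (_, d)) => max (2 * b + 1) (2 * d) + 1

/-- The length of the second column of a partition given by `quotientRows`. -/
def quotientCol₁ : HookPair → ℕ
  | (none, none) => 0
  | (some (a, _), none) => min a 1
  | (none, some _) => 1
  | (some (_, b), some (_, d)) => min (2 * b + 1) (2 * d) + 2

theorem lt_quotientCol₀ (p : HookPair) (i : ℕ) : i < quotientCol₀ p ↔ 1 ≤ quotientRows p i := by
  rcases p with ⟨_ | ⟨a, b⟩, _ | ⟨c, d⟩⟩ <;> rcases i with _ | _ | i <;>
      simp [quotientRows, doubleHookRows, quotientCol₀] <;> (try split_ifs) <;> omega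

theorem lt_quotientCol₁ (p : HookPair) (i : ℕ) : i < quotientCol₁ p ↔ 2 ≤ quotientRows p i := by
  rcases p with ⟨_ | ⟨a, b⟩, _ | ⟨c, d⟩⟩ <;> rcases i with _ | _ | i <;>
      simp [quotientRows, doubleHookRows, quotientCol₁] <;> (try split_ifs) <;> omega

theorem exists_hookStrip_of_stripRows {x : ℕ → ℕ} (hx : Antitone x) {d₀ d₁ : ℕ}
    (hd₀ : ∀ i, i < d₀ ↔ 1 ≤ x i) (hd₁ : ∀ i, i < d₁ ↔ 2 ≤ x i) (q : HookPair)
    (h : StripRows x (quotientRows q)) :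
    ∃ p, x = quotientRows p ∧ HookStrip p.1 q.1 ∧ HookStrip p.2 q.2 := by
  have hy2 : quotientRows q 2 ≤ 2 := by
    rcases q with ⟨_ | ⟨a, b⟩, _ | ⟨c, d⟩⟩ <;> exact doubleHookRows_add_two_le _ _ _ _ 0
  have hb := hookBounds (antitone_quotientRows q) hd₀ hd₁ (lt_quotientCol₀ q)
    (lt_quotientCol₁ q) hy2 h
  have hC₀ := lt_quotientCol₀ q
  have hC₁ := lt_quotientCol₁ q
  rcases q with ⟨_ | ⟨a, b⟩, _ | ⟨c, d⟩⟩
  · refine ⟨(none, none), funext fun i => ?_, trivial, trivial⟩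
    have h0 : quotientRows (none, none) i = 0 := by simp [quotientRows, doubleHookRows]
    have := h.1 i
    omega
  · have := exists_quotientRows_of_hook hx hd₀ hd₁ hC₀ hb h
      (by simp [quotientRows, doubleHookRows])
      (by simp [quotientRows, doubleHookRows, quotientCol₀]; omega)
    simpa [quotientRows, doubleHookRows, quotientCol₀] using this
  · have := exists_quotientRows_of_hook hx hd₀ hd₁ hC₀ hb h
      (by simp [quotientRows, doubleHookRows])
      (by simp [quotientRows, doubleHookRows, quotientCol₀]; omega)
    have e : (2 * a + 1) % 2 = 1 := by omega
    simpa [quotientRows, doubleHookRows, quotientCol₀, e] using this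
  · by_cases hx1 : 2 ≤ x 1
    · exact exists_quotientRows_of_two_le hx hd₀ hd₁ hb h rfl rfl rfl hx1
    · exact exists_quotientRows_hook hx hd₀ hd₁ hC₀ hC₁ hb h rfl rfl rfl (by omega)

end TypeB

/-! ### Young diagrams attached to pairs of hooks -/

namespace TypeB

theorem quotientRows_injective : Function.Injective quotientRows := by
  intro p q h
  have e0 := congrFun h 0
  have e1 := congrFun h 1
  have c0 : quotientCol₀ p = quotientCol₀ q := by
    refine eq_of_forall_lt_iff fun i => ?_
    rw [lt_quotientCol₀, lt_quotientCol₀, h]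
  have c1 : quotientCol₁ p = quotientCol₁ q := by
    refine eq_of_forall_lt_iff fun i => ?_
    rw [lt_quotientCol₁, lt_quotientCol₁, h]
  clear h
  rcases p with ⟨_ | ⟨a, b⟩, _ | ⟨c, d⟩⟩ <;> rcases q with ⟨_ | ⟨a', b'⟩, _ | ⟨c', d'⟩⟩ <;>
    simp only [quotientRows, doubleHookRows_zero, doubleHookRows_one, quotientCol₀,
      quotientCol₁] at e0 e1 c0 c1 <;> simp only [Prod.mk.injEq, Option.some.injEq,
        reduceCtorEq, true_and, and_true, and_false, false_and] <;> omega

theorem sum_doubleHookRows {r₀ r₁ c₀ c₁ N : ℕ} (h : c₁ ≤ c₀) (hN : c₀ ≤ N + 2) :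
    ∑ i ∈ Finset.range (N + 2), doubleHookRows r₀ r₁ c₀ c₁ i =
      r₀ + r₁ + (c₁ - 2) + (c₀ - 2) := by
  have key : ∀ c ≤ N + 2, ∑ i ∈ Finset.range N, (if i + 2 < c then 1 else 0) = c - 2 := by
    intro c hc
    rw [← Finset.sum_filter, Finset.sum_const, smul_eq_mul, mul_one]
    have : (Finset.range N).filter (fun i => i + 2 < c) = Finset.range (c - 2) := by
      ext i
      simp only [Finset.mem_filter, Finset.mem_range]
      omega
    rw [this, Finset.card_range]
  rw [Finset.sum_range_succ', Finset.sum_range_succ', doubleHookRows_zero, zero_add,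
    doubleHookRows_one, ← key c₀ hN]
  have e : ∀ i, doubleHookRows r₀ r₁ c₀ c₁ (i + 1 + 1) =
      (if i + 2 < c₁ then 1 else 0) + (if i + 2 < c₀ then 1 else 0) := by
    intro i
    rw [doubleHookRows_add_two]
    split_ifs <;> omega
  rw [Finset.sum_congr rfl fun i _ => e i, Finset.sum_add_distrib, key c₁ (h.trans hN)]
  omega

/-- The number of cells of a possibly empty hook. -/
def hookSize : Option (ℕ × ℕ) → ℕ
  | none => 0
  | some p => p.1 + p.2 + 1

/-- The Young diagram with empty `2`-core whose `2`-quotient is a pair of hooks. -/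
def quotientShape (p : HookPair) : YoungDiagram where
  cells := (Finset.range (quotientCol₀ p) ×ˢ Finset.range (quotientRows p 0)).filter
    fun c => c.2 < quotientRows p c.1
  isLowerSet := by
    rintro ⟨i, j⟩ ⟨i', j'⟩ hle h
    have hle' : i' ≤ i ∧ j' ≤ j := hle
    have := antitone_quotientRows p hle'.1
    simp only [Finset.coe_filter, Finset.mem_product, Finset.mem_range, Set.mem_ofPred_eq] at h ⊢
    omega

theorem mem_quotientShape {p : HookPair} {i j : ℕ} :
    (i, j) ∈ quotientShape p ↔ j < quotientRows p i := by
  rw [← YoungDiagram.mem_cells]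
  simp only [quotientShape, Finset.mem_filter, Finset.mem_product, Finset.mem_range]
  have := antitone_quotientRows p (Nat.zero_le i)
  have := lt_quotientCol₀ p i
  omega

theorem rowLen_quotientShape (p : HookPair) : (quotientShape p).rowLen = quotientRows p := by
  funext i
  refine eq_of_forall_lt_iff fun j => ?_
  rw [← YoungDiagram.mem_iff_lt_rowLen, mem_quotientShape]

theorem card_eq_sum_rowLen (μ : YoungDiagram) {N : ℕ} (hN : μ.rowLen N = 0) :
    μ.card = ∑ i ∈ Finset.range N, μ.rowLen i := by
  rw [YoungDiagram.card, Finset.card_eq_sum_card_fiberwise (f := Prod.fst) (t := Finset.range N)]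
  · refine Finset.sum_congr rfl fun i _ => ?_
    rw [YoungDiagram.rowLen_eq_card]
    rfl
  · rintro ⟨i, j⟩ hc
    have h : j < μ.rowLen i := YoungDiagram.mem_iff_lt_rowLen.1 hc
    simp only [Finset.coe_range, Set.mem_Iio]
    by_contra hi
    have := μ.rowLen_anti N i (by omega)
    omega

theorem card_quotientShape (p : HookPair) :
    (quotientShape p).card = 2 * (hookSize p.1 + hookSize p.2) := by
  rw [card_eq_sum_rowLen (N := quotientCol₀ p + 2)]
  · rw [rowLen_quotientShape]
    rcases p with ⟨_ | ⟨a, b⟩, _ | ⟨c, d⟩⟩ <;> simp only [quotientRows, quotientCol₀, hookSize] <;>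
      rw [sum_doubleHookRows (by omega) (by omega)] <;> omega
  · rw [rowLen_quotientShape]
    have := lt_quotientCol₀ p (quotientCol₀ p + 2)
    omega

theorem quotientShape_injective : Function.Injective quotientShape := by
  intro p q h
  apply quotientRows_injective
  rw [← rowLen_quotientShape, h, rowLen_quotientShape]

theorem youngDiagram_ext {μ ν : YoungDiagram} (h : μ.rowLen = ν.rowLen) : μ = ν := by
  ext ⟨i, j⟩
  rw [YoungDiagram.mem_cells, YoungDiagram.mem_cells, YoungDiagram.mem_iff_lt_rowLen, h,
    YoungDiagram.mem_iff_lt_rowLen]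

/-- This is the 2-quotient rule for domino strips. As μ is arbitrary, it also says that removing a
strip never leaves the class of hook quotients, which closes the recursion on the largest label. -/
theorem stripRows_quotientShape_iff {μ : YoungDiagram} {q : HookPair} :
    StripRows μ.rowLen (quotientShape q).rowLen ↔
      ∃ p, μ = quotientShape p ∧ HookStrip p.1 q.1 ∧ HookStrip p.2 q.2 := by
  rw [rowLen_quotientShape]
  constructor
  · intro h
    obtain ⟨p, hp, h1, h2⟩ := exists_hookStrip_of_stripRows (d₀ := μ.colLen 0) (d₁ := μ.colLen 1)
      (fun i j hij => μ.rowLen_anti i j hij)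
      (fun i => by rw [← YoungDiagram.mem_iff_lt_colLen, YoungDiagram.mem_iff_lt_rowLen]; rfl)
      (fun i => by rw [← YoungDiagram.mem_iff_lt_colLen, YoungDiagram.mem_iff_lt_rowLen]; rfl) q h
    exact ⟨p, youngDiagram_ext (by rw [hp, rowLen_quotientShape]), h1, h2⟩
  · rintro ⟨p, rfl, h1, h2⟩
    rw [rowLen_quotientShape]
    exact stripRows_of_hookStrip h1 h2

/-! ### Weighted count of horizontal strips on pairs of hooks -/

/-- The possibly empty hooks with `n` cells. -/
def hooks : ℕ → Finset (Option (ℕ × ℕ))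
  | 0 => {none}
  | n + 1 => (Finset.HasAntidiagonal.antidiagonal n).image some

theorem mem_hooks {n : ℕ} {p : Option (ℕ × ℕ)} : p ∈ hooks n ↔ hookSize p = n := by
  rcases n with _ | n <;> rcases p with _ | ⟨a, b⟩ <;> simp [hooks, hookSize]

/-- The pairs of possibly empty hooks with `n` cells in total. -/
def hookPairs (n : ℕ) : Finset HookPair :=
  (Finset.HasAntidiagonal.antidiagonal n).biUnion fun ij => hooks ij.1 ×ˢ hooks ij.2

theorem mem_hookPairs {n : ℕ} {p : HookPair} :
    p ∈ hookPairs n ↔ hookSize p.1 + hookSize p.2 = n := by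
  simp [hookPairs, mem_hooks]

/-- The weight of a possibly empty hook. -/
def hookWeight : Option (ℕ × ℕ) → ℕ
  | none => 1
  | some _ => 2

-- For k > 0 a nonempty hook has two extensions of the same weight: all new cells in the arm, or one
-- of them in the leg. The empty hook has only the one-row extension, whose weight is doubled. The
-- weight is chosen so that both cases give the factor 2.
open Classical in
theorem sum_hookWeight_strip (p : Option (ℕ × ℕ)) (k : ℕ) :
    ∑ q ∈ (hooks (hookSize p + k)).filter (HookStrip p), hookWeight q =
      hookWeight p * if k = 0 then 1 else 2 := by
  rcases p with _ | ⟨a, b⟩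
  · have : (hooks (hookSize none + k)).filter (HookStrip none) =
        {if k = 0 then none else some (k - 1, 0)} := by
      ext q
      rw [Finset.mem_filter, mem_hooks, Finset.mem_singleton]
      rcases q with _ | ⟨c, d⟩ <;> simp only [hookSize, HookStrip] <;> split_ifs <;>
        simp <;> omega
    rw [this, Finset.sum_singleton]
    split_ifs <;> rfl
  · rcases k with _ | k
    · have : (hooks (hookSize (some (a, b)) + 0)).filter (HookStrip (some (a, b))) =
          {some (a, b)} := by
        ext q
        rw [Finset.mem_filter, mem_hooks, Finset.mem_singleton]
        rcases q with _ | ⟨c, d⟩ <;> simp [hookSize, HookStrip]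
        omega
      rw [this, Finset.sum_singleton]
      rfl
    · have : (hooks (hookSize (some (a, b)) + (k + 1))).filter (HookStrip (some (a, b))) =
          {some (a + k + 1, b), some (a + k, b + 1)} := by
        ext q
        rw [Finset.mem_filter, mem_hooks, Finset.mem_insert, Finset.mem_singleton]
        rcases q with _ | ⟨c, d⟩ <;> simp [hookSize, HookStrip]
        omega
      rw [this, Finset.sum_pair (by simp)]
      rfl

theorem hookSize_le_of_hookStrip {p q : Option (ℕ × ℕ)} (h : HookStrip p q) :
    hookSize p ≤ hookSize q := by
  rcases p with _ | ⟨a, b⟩ <;> rcases q with _ | ⟨c, d⟩ <;> simp [hookSize, HookStrip] at h ⊢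
  omega

theorem sum_antidiagonal_two_pow {k : ℕ} (hk : 0 < k) :
    ∑ ij ∈ Finset.HasAntidiagonal.antidiagonal k,
      ((if ij.1 = 0 then 1 else 2) * (if ij.2 = 0 then 1 else 2)) = 4 * k := by
  obtain ⟨k, rfl⟩ : ∃ m, k = m + 1 := ⟨k - 1, by omega⟩
  rw [Finset.Nat.sum_antidiagonal_eq_sum_range_succ
    (fun i j => (if i = 0 then 1 else 2) * (if j = 0 then 1 else 2)), Finset.sum_range_succ,
    Finset.sum_range_succ']
  have : ∀ i ∈ Finset.range k, ((if i + 1 = 0 then 1 else 2) *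
      (if k + 1 - (i + 1) = 0 then 1 else 2)) = 4 := by
    intro i hi
    rw [Finset.mem_range] at hi
    rw [if_neg (by omega), if_neg (by omega)]
  rw [Finset.sum_congr rfl this]
  simp
  ring

-- The k new cells are split as i + j between the components. The two extreme splittings contribute
-- a factor 2 each and the k - 1 others a factor 4 each, in total 4k.
open Classical in
theorem sum_hookPairs_strip (p : HookPair) {k : ℕ} (hk : 0 < k) :
    ∑ q ∈ (hookPairs (hookSize p.1 + hookSize p.2 + k)).filter
        (fun q => HookStrip p.1 q.1 ∧ HookStrip p.2 q.2), hookWeight q.1 * hookWeight q.2 =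
      4 * k * (hookWeight p.1 * hookWeight p.2) := by
  rw [← Finset.sum_fiberwise_of_maps_to (t := Finset.HasAntidiagonal.antidiagonal k)
    (g := fun q => (hookSize q.1 - hookSize p.1, hookSize q.2 - hookSize p.2))]
  · have e : ∀ ij ∈ Finset.HasAntidiagonal.antidiagonal k,
        ((hookPairs (hookSize p.1 + hookSize p.2 + k)).filter
          (fun q => HookStrip p.1 q.1 ∧ HookStrip p.2 q.2)).filter
          (fun q => (hookSize q.1 - hookSize p.1, hookSize q.2 - hookSize p.2) = ij) =
        (hooks (hookSize p.1 + ij.1)).filter (HookStrip p.1) ×ˢ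
          (hooks (hookSize p.2 + ij.2)).filter (HookStrip p.2) := by
      rintro ⟨i, j⟩ hij
      rw [Finset.HasAntidiagonal.mem_antidiagonal] at hij
      ext q
      simp only [Finset.mem_filter, Finset.mem_product, mem_hookPairs, mem_hooks, Prod.mk.injEq]
      constructor
      · rintro ⟨⟨h1, h2, h3⟩, h4, h5⟩
        have := hookSize_le_of_hookStrip h2
        have := hookSize_le_of_hookStrip h3
        exact ⟨⟨by omega, h2⟩, by omega, h3⟩
      · rintro ⟨⟨h1, h2⟩, h3, h4⟩
        simp only at hij
        exact ⟨⟨by omega, h2, h4⟩, by omega, by omega⟩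
    have e' : ∀ ij ∈ Finset.HasAntidiagonal.antidiagonal k,
        ∑ q ∈ ((hookPairs (hookSize p.1 + hookSize p.2 + k)).filter
          (fun q => HookStrip p.1 q.1 ∧ HookStrip p.2 q.2)).filter
          (fun q => (hookSize q.1 - hookSize p.1, hookSize q.2 - hookSize p.2) = ij),
          hookWeight q.1 * hookWeight q.2 =
        hookWeight p.1 * hookWeight p.2 *
          ((if ij.1 = 0 then 1 else 2) * (if ij.2 = 0 then 1 else 2)) := by
      intro ij hij
      rw [e ij hij, Finset.sum_product, ← Finset.sum_mul_sum, sum_hookWeight_strip,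
        sum_hookWeight_strip]
      ring
    rw [Finset.sum_congr rfl e', ← Finset.mul_sum, sum_antidiagonal_two_pow hk, mul_comm]
  · intro q hq
    simp only [Finset.mem_filter, mem_hookPairs, Finset.HasAntidiagonal.mem_antidiagonal] at hq ⊢
    have := hookSize_le_of_hookStrip hq.2.1
    have := hookSize_le_of_hookStrip hq.2.2
    omega

end TypeB

/-! ### Existence and uniqueness of the tiling of a domino strip -/

namespace TypeB

/-- A tiling of the skew shape `ν / μ` by dominoes, distinct ones having no column in common. -/
structure IsStripTiling (μ ν : YoungDiagram) (D : Finset (Finset (ℕ × ℕ))) : Prop where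
  domino : ∀ d ∈ D, IsDomino d ∧ ∀ c ∈ d, c ∈ ν ∧ c ∉ μ
  cover : ∀ c, c ∈ ν → c ∉ μ → ∃ d ∈ D, c ∈ d
  col : ∀ d ∈ D, ∀ e ∈ D, ∀ i i' j, (i, j) ∈ d → (i', j) ∈ e → d = e

/-- The first column of row `i` whose only cell in `ν / μ` lies in row `i`. -/
def singleStart (μ ν : YoungDiagram) (i : ℕ) : ℕ := max (μ.rowLen i) (ν.rowLen (i + 1))

/-- The end of the columns whose only cell in `ν / μ` lies in row `i`. -/
def singleEnd (μ ν : YoungDiagram) : ℕ → ℕ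
  | 0 => ν.rowLen 0
  | i + 1 => min (ν.rowLen (i + 1)) (μ.rowLen i)

/-- The dominoes in the only possible strip tiling of `ν / μ`. -/
def IsStripDomino (μ ν : YoungDiagram) (d : Finset (ℕ × ℕ)) : Prop :=
  (∃ i j, μ.rowLen i ≤ j ∧ j < ν.rowLen (i + 1) ∧ d = {(i, j), (i + 1, j)}) ∨
  ∃ i k, singleStart μ ν i + 2 * k + 1 < singleEnd μ ν i ∧
    d = {(i, singleStart μ ν i + 2 * k), (i, singleStart μ ν i + 2 * k + 1)}

theorem lt_singleEnd {μ ν : YoungDiagram} {i j : ℕ} :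
    j < singleEnd μ ν i ↔ (i, j) ∈ ν ∧ ∀ i', i' < i → (i', j) ∈ μ := by
  rcases i with _ | i
  · simp [singleEnd, YoungDiagram.mem_iff_lt_rowLen]
  · simp only [singleEnd, lt_min_iff, YoungDiagram.mem_iff_lt_rowLen]
    refine and_congr_right fun _ => ⟨fun h i' hi' => ?_, fun h => h i (by omega)⟩
    have := μ.rowLen_anti i' i (by omega)
    omega

theorem singleStart_le {μ ν : YoungDiagram} {i j : ℕ} :
    singleStart μ ν i ≤ j ↔ (i, j) ∉ μ ∧ (i + 1, j) ∉ ν := by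
  simp [singleStart, YoungDiagram.mem_iff_lt_rowLen]

namespace IsStripTiling

variable {μ ν : YoungDiagram} {D : Finset (Finset (ℕ × ℕ))}

theorem mem_of_mem_col (hD : IsStripTiling μ ν D) {d : Finset (ℕ × ℕ)} (hd : d ∈ D) {i i' j : ℕ}
    (h : (i, j) ∈ d) (h1 : (i', j) ∈ ν) (h2 : (i', j) ∉ μ) : (i', j) ∈ d := by
  obtain ⟨e, he, hc⟩ := hD.cover _ h1 h2
  rwa [hD.col d hd e he i i' j h hc]

/-- Otherwise some column has three new cells, which would all lie in one domino. -/
theorem rowLen_add_two_le (hD : IsStripTiling μ ν D) (i : ℕ) :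
    ν.rowLen (i + 2) ≤ μ.rowLen i := by
  by_contra! h
  have hm : ∀ k, (i + k, μ.rowLen i) ∉ μ := by
    intro k
    rw [YoungDiagram.mem_iff_lt_rowLen]
    have := μ.rowLen_anti i (i + k) (by omega)
    omega
  have hn : ∀ k ≤ 2, (i + k, μ.rowLen i) ∈ ν := by
    intro k hk
    rw [YoungDiagram.mem_iff_lt_rowLen]
    have := ν.rowLen_anti (i + k) (i + 2) (by omega)
    omega
  obtain ⟨d, hd, hc⟩ := hD.cover _ (hn 0 (by omega)) (hm 0)
  have h1 := hD.mem_of_mem_col hd hc (hn 1 (by omega)) (hm 1)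
  have h2 := hD.mem_of_mem_col hd hc (hn 2 (by omega)) (hm 2)
  obtain ⟨⟨a, b, rfl | rfl⟩, -⟩ := hD.domino d hd <;> simp at hc h1 h2 <;> omega

/-- A domino covering a column with one new cell is horizontal, and its other column also has only
one new cell: a further cell there would be forced into the same domino. -/
theorem eq_of_single (hD : IsStripTiling μ ν D) {d : Finset (ℕ × ℕ)} (hd : d ∈ D) {i j : ℕ}
    (hc : (i, j) ∈ d) (h1 : singleStart μ ν i ≤ j) (h2 : j < singleEnd μ ν i) :
    (d = {(i, j), (i, j + 1)} ∧ j + 1 < singleEnd μ ν i) ∨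
      ∃ j', j = j' + 1 ∧ d = {(i, j'), (i, j' + 1)} ∧ singleStart μ ν i ≤ j' := by
  obtain ⟨⟨a, b, hab⟩, hsub⟩ := hD.domino d hd
  rw [singleStart_le] at h1
  rw [lt_singleEnd] at h2
  rcases hab with hab | hab
  · have ha : a = i ∧ (j = b ∨ j = b + 1) := by
      rw [hab] at hc
      simp at hc
      omega
    obtain ⟨rfl, rfl | rfl⟩ := ha
    · refine Or.inl ⟨hab, lt_singleEnd.2 ⟨(hsub (a, j + 1) (by simp [hab])).1, ?_⟩⟩
      intro i' hi'
      by_contra hn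
      have hm := hD.mem_of_mem_col hd (i := a) (i' := i') (j := j + 1) (by simp [hab])
        (ν.up_left_mem hi'.le le_rfl (hsub (a, j + 1) (by simp [hab])).1) hn
      rw [hab] at hm
      simp at hm
      omega
    · refine Or.inr ⟨b, rfl, hab, singleStart_le.2 ⟨(hsub (a, b) (by simp [hab])).2, ?_⟩⟩
      intro hn
      have hm := hD.mem_of_mem_col hd (i := a) (i' := a + 1) (j := b) (by simp [hab]) hn
        (fun h => (hsub (a, b) (by simp [hab])).2 (μ.up_left_mem (by omega) le_rfl h))
      rw [hab] at hm
      simp at hm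
  · have ha : b = j ∧ (i = a ∨ i = a + 1) := by
      rw [hab] at hc
      simp at hc
      omega
    obtain ⟨rfl, rfl | rfl⟩ := ha
    · exact absurd (hsub (i + 1, b) (by simp [hab])).1 h1.2
    · exact absurd (h2.2 a (by omega)) (hsub (a, b) (by simp [hab])).2

/-- The interval of single-cell columns of a row is tiled from the left: by induction on k the
previous domino ends just before this cell, so the domino covering it extends to the right. -/
theorem horizontal_mem (hD : IsStripTiling μ ν D) (i k : ℕ)
    (h : singleStart μ ν i + 2 * k < singleEnd μ ν i) :
    {(i, singleStart μ ν i + 2 * k), (i, singleStart μ ν i + 2 * k + 1)} ∈ D ∧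
      singleStart μ ν i + 2 * k + 1 < singleEnd μ ν i := by
  have hcell : (i, singleStart μ ν i + 2 * k) ∈ ν ∧ (i, singleStart μ ν i + 2 * k) ∉ μ :=
    ⟨(lt_singleEnd.1 h).1, (singleStart_le.1 (by omega : singleStart μ ν i ≤ _)).1⟩
  obtain ⟨d, hd, hc⟩ := hD.cover _ hcell.1 hcell.2
  rcases hD.eq_of_single hd hc (by omega) h with ⟨rfl, h2⟩ | ⟨j', hj, rfl, h3⟩
  · exact ⟨hd, h2⟩
  · exfalso
    rcases k with _ | k
    · omega
    · have ih := (hD.horizontal_mem i k (by omega)).1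
      have := hD.col _ hd _ ih i i j' (by simp) (by simp; omega)
      have hm : (i, j' + 1) ∈ ({(i, j'), (i, j' + 1)} : Finset (ℕ × ℕ)) := by simp
      rw [this] at hm
      simp at hm
      omega

/-- Everything is forced: two-cell columns carry vertical dominoes, and single-cell columns are
paired from the left. Hence the tiling depends on μ and ν alone. -/
theorem mem_iff (hD : IsStripTiling μ ν D) (d : Finset (ℕ × ℕ)) :
    d ∈ D ↔ IsStripDomino μ ν d := by
  constructor
  · intro hd
    obtain ⟨⟨a, b, hab⟩, hsub⟩ := hD.domino d hd
    rcases hab with hab | hab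
    · have h1 := hsub (a, b) (by simp [hab])
      have hs : singleStart μ ν a ≤ b := by
        refine singleStart_le.2 ⟨h1.2, fun hn => ?_⟩
        have hm := hD.mem_of_mem_col hd (i := a) (i' := a + 1) (j := b) (by simp [hab]) hn
          (fun h => h1.2 (μ.up_left_mem (by omega) le_rfl h))
        rw [hab] at hm
        simp at hm
      have he : b < singleEnd μ ν a := by
        refine lt_singleEnd.2 ⟨h1.1, fun i' hi' => ?_⟩
        by_contra hn
        have hm := hD.mem_of_mem_col hd (i := a) (i' := i') (j := b) (by simp [hab])
          (ν.up_left_mem hi'.le le_rfl h1.1) hn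
        rw [hab] at hm
        simp at hm
        omega
      obtain ⟨k, hk | hk⟩ : ∃ k, b = singleStart μ ν a + 2 * k ∨
          b = singleStart μ ν a + 2 * k + 1 := ⟨(b - singleStart μ ν a) / 2, by omega⟩
      · have := hD.horizontal_mem a k (by omega)
        exact Or.inr ⟨a, k, this.2, by rw [hab, hk]⟩
      · have := (hD.horizontal_mem a k (by omega)).1
        have := hD.col _ hd _ this a a b (by simp [hab]) (by simp; omega)
        have hm : (a, b + 1) ∈ d := by simp [hab]
        rw [this] at hm
        simp at hm
        omega
    · have h1 := hsub (a, b) (by simp [hab])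
      have h2 := hsub (a + 1, b) (by simp [hab])
      rw [YoungDiagram.mem_iff_lt_rowLen, YoungDiagram.mem_iff_lt_rowLen] at h1 h2
      exact Or.inl ⟨a, b, by omega, by omega, hab⟩
  · rintro (⟨i, j, h1, h2, rfl⟩ | ⟨i, k, h1, rfl⟩)
    · have hm : ∀ a, i ≤ a → (a, j) ∉ μ := by
        intro a ha h
        rw [YoungDiagram.mem_iff_lt_rowLen] at h
        have := μ.rowLen_anti i a ha
        omega
      have hn : (i + 1, j) ∈ ν := YoungDiagram.mem_iff_lt_rowLen.2 h2
      obtain ⟨d, hd, hc⟩ := hD.cover _ (ν.up_left_mem (Nat.le_succ i) le_rfl hn) (hm i le_rfl)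
      have hc' := hD.mem_of_mem_col hd hc hn (hm _ (Nat.le_succ i))
      obtain ⟨⟨a, b, rfl | rfl⟩, -⟩ := hD.domino d hd
      · simp at hc hc'
        omega
      · have : a = i ∧ b = j := by
          simp at hc hc'
          omega
        rwa [this.1, this.2] at hd
    · exact (hD.horizontal_mem i k (by omega)).1

theorem eq (hD : IsStripTiling μ ν D) {D' : Finset (Finset (ℕ × ℕ))}
    (hD' : IsStripTiling μ ν D') : D = D' := by
  ext d
  rw [hD.mem_iff, hD'.mem_iff]

theorem even_single (hD : IsStripTiling μ ν D) (i : ℕ) :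
    Even (singleEnd μ ν i - singleStart μ ν i) := by
  by_contra h
  rw [Nat.not_even_iff_odd] at h
  obtain ⟨k, hk⟩ := h
  have := (hD.horizontal_mem i k (by omega)).2
  omega

theorem stripRows (hD : IsStripTiling μ ν D) (h : μ ≤ ν) : StripRows μ.rowLen ν.rowLen := by
  refine ⟨fun i => ?_, hD.rowLen_add_two_le, hD.even_single 0, fun i => hD.even_single (i + 1)⟩
  by_contra! hi
  exact absurd (YoungDiagram.mem_iff_lt_rowLen.1 (h (YoungDiagram.mem_iff_lt_rowLen.2 hi)))
    (lt_irrefl _)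

end IsStripTiling

/-- The forced dominoes do form a tiling: evenness completes the horizontal pairs, and the bound on
row i + 2 prevents two vertical dominoes from sharing a column. -/
theorem exists_isStripTiling {μ ν : YoungDiagram} (h : StripRows μ.rowLen ν.rowLen) :
    ∃ D, IsStripTiling μ ν D := by
  classical
  obtain ⟨hle, hle2, hev0, hev⟩ := h
  have hev' : ∀ i, Even (singleEnd μ ν i - singleStart μ ν i) := by
    rintro (_ | i)
    · exact hev0
    · exact hev i
  have hsub : ∀ d, IsStripDomino μ ν d → ∀ c ∈ d, c ∈ ν ∧ c ∉ μ := by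
    rintro d (⟨i, j, h1, h2, rfl⟩ | ⟨i, k, h1, rfl⟩) c hc
    · have := ν.rowLen_anti i (i + 1) (by omega)
      have := μ.rowLen_anti i (i + 1) (by omega)
      simp only [Finset.mem_insert, Finset.mem_singleton] at hc
      rcases hc with rfl | rfl <;>
        rw [YoungDiagram.mem_iff_lt_rowLen, YoungDiagram.mem_iff_lt_rowLen] <;> omega
    · simp only [Finset.mem_insert, Finset.mem_singleton] at hc
      rcases hc with rfl | rfl
      · exact ⟨(lt_singleEnd.1 ((Nat.lt_succ_self _).trans h1)).1,
          (singleStart_le.1 (by omega : singleStart μ ν i ≤ _)).1⟩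
      · exact ⟨(lt_singleEnd.1 h1).1, (singleStart_le.1 (by omega : singleStart μ ν i ≤ _)).1⟩
  refine ⟨ν.cells.powerset.filter (IsStripDomino μ ν), ?_, ?_, ?_⟩
  · intro d hd
    rw [Finset.mem_filter] at hd
    refine ⟨?_, hsub d hd.2⟩
    obtain ⟨i, j, -, -, rfl⟩ | ⟨i, k, -, rfl⟩ := hd.2
    · exact ⟨i, j, Or.inr rfl⟩
    · exact ⟨i, _, Or.inl rfl⟩
  · rintro ⟨i, j⟩ h1 h2
    suffices ∃ d, IsStripDomino μ ν d ∧ (i, j) ∈ d by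
      obtain ⟨d, hd, hc⟩ := this
      refine ⟨d, Finset.mem_filter.2 ⟨Finset.mem_powerset.2 fun c hc => ?_, hd⟩, hc⟩
      exact (YoungDiagram.mem_cells _).2 (hsub d hd c hc).1
    by_cases h3 : (i + 1, j) ∈ ν
    · exact ⟨_, Or.inl ⟨i, j, by simpa [YoungDiagram.mem_iff_lt_rowLen] using h2,
        YoungDiagram.mem_iff_lt_rowLen.1 h3, rfl⟩, by simp⟩
    by_cases h4 : ∃ i', i = i' + 1 ∧ (i', j) ∉ μ
    · obtain ⟨i', rfl, h4⟩ := h4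
      exact ⟨_, Or.inl ⟨i', j, by simpa [YoungDiagram.mem_iff_lt_rowLen] using h4,
        YoungDiagram.mem_iff_lt_rowLen.1 h1, rfl⟩, by simp⟩
    have hs : singleStart μ ν i ≤ j := singleStart_le.2 ⟨h2, h3⟩
    have he : j < singleEnd μ ν i := by
      refine lt_singleEnd.2 ⟨h1, fun i' hi' => ?_⟩
      push Not at h4
      exact μ.up_left_mem (by omega : i' ≤ i - 1) le_rfl (h4 (i - 1) (by omega))
    obtain ⟨m, hm⟩ := hev' i
    refine ⟨_, Or.inr ⟨i, (j - singleStart μ ν i) / 2, by omega, rfl⟩, ?_⟩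
    simp
    omega
  · intro d hd e he i i' j hc hc'
    rw [Finset.mem_filter] at hd he
    replace hd := hd.2
    replace he := he.2
    have hV : ∀ a b, μ.rowLen a ≤ j → j < ν.rowLen (a + 1) → μ.rowLen b ≤ j →
        j < ν.rowLen (b + 1) → a ≤ b := by
      intro a b h1 h2 h3 h4
      by_contra! hab
      have := hle2 b
      have := ν.rowLen_anti (b + 2) (a + 1) (by omega)
      omega
    have hH : ∀ a b, singleStart μ ν a ≤ j → j < singleEnd μ ν b → b ≤ a := by
      intro a b h1 h2
      by_contra! hab
      exact (singleStart_le.1 h1).1 ((lt_singleEnd.1 h2).2 a hab)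
    have hVH : ∀ a b, μ.rowLen a ≤ j → j < ν.rowLen (a + 1) → singleStart μ ν b ≤ j →
        j < singleEnd μ ν b → False := by
      intro a b h1 h2 h3 h4
      have h5 := singleStart_le.1 h3
      have h6 := lt_singleEnd.1 h4
      rcases Nat.lt_or_ge a b with hab | hab
      · have := YoungDiagram.mem_iff_lt_rowLen.1 (h6.2 a hab)
        omega
      · exact h5.2 (ν.up_left_mem (by omega) le_rfl (YoungDiagram.mem_iff_lt_rowLen.2 h2))
    obtain ⟨a, b, h1, h2, rfl⟩ | ⟨a, k, h1, rfl⟩ := hd <;>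
    obtain ⟨a', b', h1', h2', rfl⟩ | ⟨a', k', h1', rfl⟩ := he <;>
    simp only [Finset.mem_insert, Finset.mem_singleton, Prod.mk.injEq] at hc hc'
    · have hb : b = j ∧ b' = j := by omega
      obtain ⟨rfl, rfl⟩ := hb
      rw [le_antisymm (hV a a' h1 h2 h1' h2') (hV a' a h1' h2' h1 h2)]
    · have hb : b = j := by omega
      subst hb
      exact (hVH a a' h1 h2 (by omega) (by omega)).elim
    · have hb : b' = j := by omega
      subst hb
      exact (hVH a' a h1' h2' (by omega) (by omega)).elim
    · have ha : a = a' := le_antisymm (hH a' a (by omega) (by omega)) (hH a a' (by omega) (by omega))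
      subst ha
      have hk : k = k' := by omega
      rw [hk]

end TypeB

/-! ### Removing and adding the dominoes of largest label -/

namespace TypeB

theorem IsDomino.card {d : Finset (ℕ × ℕ)} (h : IsDomino d) : d.card = 2 := by
  obtain ⟨i, j, rfl | rfl⟩ := h <;> exact Finset.card_pair (by simp)

namespace IsSSDT

variable {μ ν : YoungDiagram} {T : Finset (Finset (ℕ × ℕ) × ℕ)}

theorem eq_of_mem (hT : IsSSDT μ T) {p q : Finset (ℕ × ℕ) × ℕ} (hp : p ∈ T) (hq : q ∈ T)
    {c : ℕ × ℕ} (h1 : c ∈ p.1) (h2 : c ∈ q.1) : p = q :=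
  (hT.cover c ((hT.domino p hp).2 h1)).unique ⟨hp, h1⟩ ⟨hq, h2⟩

theorem cells_eq (hT : IsSSDT μ T) : μ.cells = T.biUnion Prod.fst := by
  ext c
  rw [Finset.mem_biUnion]
  constructor
  · intro hc
    obtain ⟨p, hp, -⟩ := hT.cover c hc
    exact ⟨p, hp⟩
  · rintro ⟨p, hp, hc⟩
    exact (hT.domino p hp).2 hc

theorem card_eq (hT : IsSSDT μ T) : μ.card = 2 * T.card := by
  rw [YoungDiagram.card, hT.cells_eq, Finset.card_biUnion, Finset.sum_congr rfl
    fun p hp => (hT.domino p hp).1.card, Finset.sum_const, smul_eq_mul, mul_comm]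
  intro p hp q hq hpq
  rw [Function.onFun, Finset.disjoint_left]
  intro c h1 h2
  exact hpq (hT.eq_of_mem hp hq h1 h2)

/-- Labels weakly increase towards the south-east. -/
theorem le_of_mem (hT : IsSSDT μ T) {p q : Finset (ℕ × ℕ) × ℕ} (hp : p ∈ T) (hq : q ∈ T)
    {i j i' j' : ℕ} (h1 : (i, j) ∈ p.1) (h2 : (i', j') ∈ q.1) (hi : i ≤ i') (hj : j ≤ j') :
    p.2 ≤ q.2 := by
  obtain ⟨r, ⟨hr, hc⟩, -⟩ := hT.cover (i, j')
    (μ.up_left_mem hi le_rfl ((hT.domino q hq).2 h2))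
  have e1 : p.2 ≤ r.2 := by
    rcases hj.eq_or_lt with rfl | hj
    · rw [hT.eq_of_mem hp hr h1 hc]
    · exact hT.row_weak p hp r hr i j j' h1 hc hj
  have e2 : r.2 ≤ q.2 := by
    by_cases hrq : r = q
    · rw [hrq]
    rcases hi.eq_or_lt with rfl | hi
    · exact absurd (hT.eq_of_mem hr hq hc h2) hrq
    · exact (hT.col_strict r hr q hq hrq i i' j' hc h2 hi).le
  exact e1.trans e2

end IsSSDT

theorem degree_tableauWeight (T : Finset (Finset (ℕ × ℕ) × ℕ)) :
    (tableauWeight T).degree = T.card := by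
  simp [tableauWeight, map_sum, Finsupp.degree_single]

theorem mem_support_tableauWeight {T : Finset (Finset (ℕ × ℕ) × ℕ)} {a : ℕ} :
    a ∈ (tableauWeight T).support ↔ ∃ p ∈ T, p.2 = a := by
  simp [tableauWeight, Finsupp.finsetSum_apply, Finsupp.single_apply]

/-- Labels increase weakly to the south-east, so the cells with label different from the maximum
form a Young diagram; strictness down columns makes the dominoes with the maximal label a strip. -/
theorem exists_remove_max {ν : YoungDiagram} {T : Finset (Finset (ℕ × ℕ) × ℕ)}
    (hT : IsSSDT ν T) {a : ℕ} (ha : ∀ p ∈ T, p.2 ≤ a) :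
    ∃ μ ≤ ν, IsSSDT μ (T.filter fun p => p.2 ≠ a) ∧
      IsStripTiling μ ν ((T.filter fun p => p.2 = a).image Prod.fst) := by
  have hcell : ∀ {c p}, p ∈ T → c ∈ p.1 → (∃ q ∈ T, q.2 ≠ a ∧ c ∈ q.1) → p.2 ≠ a := by
    rintro c p hp hc ⟨q, hq, hqa, hc'⟩
    rwa [hT.eq_of_mem hp hq hc hc']
  let μ : YoungDiagram :=
    { cells := ν.cells.filter fun c => ∃ p ∈ T, p.2 ≠ a ∧ c ∈ p.1
      isLowerSet := by
        rintro ⟨i, j⟩ ⟨i', j'⟩ hle h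
        have hle' : i' ≤ i ∧ j' ≤ j := hle
        simp only [Finset.coe_filter, Set.mem_ofPred_eq] at h ⊢
        obtain ⟨hν, q, hq, hqa, hc⟩ := h
        have hν' : (i', j') ∈ ν.cells := ν.up_left_mem hle'.1 hle'.2 hν
        obtain ⟨p, ⟨hp, hc'⟩, -⟩ := hT.cover _ hν'
        have := hT.le_of_mem hp hq hc' hc hle'.1 hle'.2
        have := ha q hq
        exact ⟨hν', p, hp, by omega, hc'⟩ }
  have hμ : ∀ c, c ∈ μ ↔ c ∈ ν ∧ ∃ p ∈ T, p.2 ≠ a ∧ c ∈ p.1 := by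
    intro c
    rw [← YoungDiagram.mem_cells, Finset.mem_filter, YoungDiagram.mem_cells]
  refine ⟨μ, fun c hc => ((hμ c).1 hc).1, ?_, ?_⟩
  · constructor
    · intro p hp
      rw [Finset.mem_filter] at hp
      refine ⟨(hT.domino p hp.1).1, fun c hc => ?_⟩
      rw [YoungDiagram.mem_cells, hμ]
      exact ⟨(hT.domino p hp.1).2 hc, p, hp.1, hp.2, hc⟩
    · intro c hc
      rw [YoungDiagram.mem_cells, hμ] at hc
      obtain ⟨hν, p, hp, hpa, hc⟩ := hc
      refine ⟨p, ⟨Finset.mem_filter.2 ⟨hp, hpa⟩, hc⟩, ?_⟩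
      rintro q ⟨hq, hc'⟩
      exact hT.eq_of_mem (Finset.mem_filter.1 hq).1 hp hc' hc
    · intro p hp q hq
      exact hT.row_weak p (Finset.mem_filter.1 hp).1 q (Finset.mem_filter.1 hq).1
    · intro p hp q hq
      exact hT.col_strict p (Finset.mem_filter.1 hp).1 q (Finset.mem_filter.1 hq).1
    · intro b hb
      exact hT.corner b (Finset.mem_filter.1 hb).1
  · constructor
    · intro d hd
      simp only [Finset.mem_image, Finset.mem_filter] at hd
      obtain ⟨p, ⟨hp, hpa⟩, rfl⟩ := hd
      refine ⟨(hT.domino p hp).1, fun c hc => ⟨(hT.domino p hp).2 hc, fun hcμ => ?_⟩⟩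
      exact hcell hp hc ((hμ c).1 hcμ).2 hpa
    · intro c hν hcμ
      obtain ⟨p, ⟨hp, hc⟩, -⟩ := hT.cover c hν
      refine ⟨p.1, Finset.mem_image.2 ⟨p, Finset.mem_filter.2 ⟨hp, ?_⟩, rfl⟩, hc⟩
      by_contra hpa
      exact hcμ ((hμ c).2 ⟨hν, p, hp, hpa, hc⟩)
    · intro d hd e he i i' j hc hc'
      simp only [Finset.mem_image, Finset.mem_filter] at hd he
      obtain ⟨p, ⟨hp, hpa⟩, rfl⟩ := hd
      obtain ⟨q, ⟨hq, hqa⟩, rfl⟩ := he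
      by_contra hpq
      have hpq' : p ≠ q := fun h => hpq (by rw [h])
      rcases lt_trichotomy i i' with h | rfl | h
      · have := hT.col_strict p hp q hq hpq' i i' j hc hc' h
        omega
      · exact hpq' (hT.eq_of_mem hp hq hc hc')
      · have := hT.col_strict q hq p hp hpq'.symm i' i j hc' hc h
        omega

/-- Inverse to removing the largest label. The row and column conditions hold since a new cell is
never north-west of an old one; only the corner condition needs a hypothesis on the strip. -/
theorem IsSSDT.insert_strip {μ ν : YoungDiagram} {T : Finset (Finset (ℕ × ℕ) × ℕ)} (hT : IsSSDT μ T)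
    (hμν : μ ≤ ν) {D : Finset (Finset (ℕ × ℕ))} (hD : IsStripTiling μ ν D) {a : ℕ}
    (ha : ∀ p ∈ T, p.2 < a)
    (hcorner : ({(0, 0), (1, 0)} : Finset (ℕ × ℕ)) ∈ D → a ≠ 0) :
    IsSSDT ν (T ∪ D.image fun d => (d, a)) := by
  have hout : ∀ p ∈ T, ∀ c ∈ p.1, c ∈ μ := fun p hp c hc => (hT.domino p hp).2 hc
  constructor
  · intro p hp
    simp only [Finset.mem_union, Finset.mem_image] at hp
    rcases hp with hp | ⟨d, hd, rfl⟩
    · exact ⟨(hT.domino p hp).1, fun c hc => hμν (hout p hp c hc)⟩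
    · exact ⟨(hD.domino d hd).1, fun c hc => ((hD.domino d hd).2 c hc).1⟩
  · intro c hc
    by_cases hcμ : c ∈ μ
    · obtain ⟨p, ⟨hp, hcp⟩, huniq⟩ := hT.cover c hcμ
      refine ⟨p, ⟨Finset.mem_union_left _ hp, hcp⟩, ?_⟩
      rintro q ⟨hq, hcq⟩
      simp only [Finset.mem_union, Finset.mem_image] at hq
      rcases hq with hq | ⟨d, hd, rfl⟩
      · exact huniq q ⟨hq, hcq⟩
      · exact absurd hcμ ((hD.domino d hd).2 c hcq).2
    · obtain ⟨d, hd, hcd⟩ := hD.cover c hc hcμ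
      refine ⟨(d, a), ⟨Finset.mem_union_right _ (Finset.mem_image_of_mem _ hd), hcd⟩, ?_⟩
      rintro q ⟨hq, hcq⟩
      simp only [Finset.mem_union, Finset.mem_image] at hq
      rcases hq with hq | ⟨e, he, rfl⟩
      · exact absurd (hout q hq c hcq) hcμ
      · rw [hD.col e he d hd c.1 c.1 c.2 hcq hcd]
  · intro p hp q hq i j j' hc hc' hj
    simp only [Finset.mem_union, Finset.mem_image] at hp hq
    rcases hp with hp | ⟨d, hd, rfl⟩ <;> rcases hq with hq | ⟨e, he, rfl⟩
    · exact hT.row_weak p hp q hq i j j' hc hc' hj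
    · exact (ha p hp).le
    · exact absurd (μ.up_left_mem le_rfl hj.le (hout q hq _ hc')) ((hD.domino d hd).2 _ hc).2
    · exact le_rfl
  · intro p hp q hq hpq i i' j hc hc' hi
    simp only [Finset.mem_union, Finset.mem_image] at hp hq
    rcases hp with hp | ⟨d, hd, rfl⟩ <;> rcases hq with hq | ⟨e, he, rfl⟩
    · exact hT.col_strict p hp q hq hpq i i' j hc hc' hi
    · exact ha p hp
    · exact absurd (μ.up_left_mem hi.le le_rfl (hout q hq _ hc')) ((hD.domino d hd).2 _ hc).2
    · exact absurd (by rw [hD.col d hd e he i i' j hc hc']) hpq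
  · intro b hb
    simp only [Finset.mem_union, Finset.mem_image, Prod.mk.injEq] at hb
    rcases hb with hb | ⟨d, hd, rfl, rfl⟩
    · exact hT.corner b hb
    · exact hcorner hd

theorem tableauWeight_insert_strip {T : Finset (Finset (ℕ × ℕ) × ℕ)}
    {D : Finset (Finset (ℕ × ℕ))} {a : ℕ} (ha : ∀ p ∈ T, p.2 < a) :
    tableauWeight (T ∪ D.image fun d => (d, a)) = tableauWeight T + Finsupp.single a D.card := by
  have hinj : Function.Injective fun d : Finset (ℕ × ℕ) => (d, a) := fun d e h => (Prod.ext_iff.1 h).1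
  rw [tableauWeight, Finset.sum_union, Finset.sum_image fun d _ e _ h => hinj h, tableauWeight]
  · simp
  · rw [Finset.disjoint_left]
    intro p hp hp'
    simp only [Finset.mem_image] at hp'
    obtain ⟨d, -, rfl⟩ := hp'
    exact lt_irrefl _ (ha _ hp)

theorem filter_insert_strip {T : Finset (Finset (ℕ × ℕ) × ℕ)}
    {D : Finset (Finset (ℕ × ℕ))} {a : ℕ} (ha : ∀ p ∈ T, p.2 < a) :
    (T ∪ D.image fun d => (d, a)).filter (fun p => p.2 ≠ a) = T := by
  ext p
  simp only [Finset.mem_filter, Finset.mem_union, Finset.mem_image]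
  constructor
  · rintro ⟨hp | ⟨d, -, rfl⟩, h⟩
    · exact hp
    · exact absurd rfl h
  · exact fun hp => ⟨Or.inl hp, (ha p hp).ne⟩

theorem insert_strip_filter (T : Finset (Finset (ℕ × ℕ) × ℕ)) (a : ℕ) :
    (T.filter fun p => p.2 ≠ a) ∪
      ((T.filter fun p => p.2 = a).image Prod.fst).image (fun d => (d, a)) = T := by
  ext ⟨d, b⟩
  simp only [Finset.mem_union, Finset.mem_filter, Finset.mem_image]
  constructor
  · rintro (h | ⟨e, ⟨p, ⟨hp, hpa⟩, rfl⟩, h⟩)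
    · exact h.1
    · rw [← h, ← hpa]
      exact hp
  · intro h
    by_cases hb : b = a
    · exact Or.inr ⟨d, ⟨_, ⟨h, hb⟩, rfl⟩, by rw [hb]⟩
    · exact Or.inl ⟨h, hb⟩

end TypeB

/-! ### Weighted count of domino tableaux of a given weight -/

namespace TypeB

/-- The semistandard domino tableaux of a given shape and weight. -/
noncomputable def ssdts (μ : YoungDiagram) (m : ℕ →₀ ℕ) : Finset (Finset (Finset (ℕ × ℕ) × ℕ)) :=
  (ssdt_finite μ m).toFinset

theorem mem_ssdts {μ : YoungDiagram} {m : ℕ →₀ ℕ} {T : Finset (Finset (ℕ × ℕ) × ℕ)} :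
    T ∈ ssdts μ m ↔ IsSSDT μ T ∧ tableauWeight T = m := by
  simp [ssdts]

theorem card_of_mem_ssdts {μ : YoungDiagram} {m : ℕ →₀ ℕ} {T : Finset (Finset (ℕ × ℕ) × ℕ)}
    (h : T ∈ ssdts μ m) : μ.card = 2 * m.degree := by
  rw [mem_ssdts] at h
  rw [h.1.card_eq, ← h.2, degree_tableauWeight]

theorem label_lt_of_weight {T : Finset (Finset (ℕ × ℕ) × ℕ)} {f : ℕ →₀ ℕ} {a : ℕ}
    (hT : tableauWeight T = f) (hf : ∀ c ∈ f.support, c < a) : ∀ p ∈ T, p.2 < a :=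
  fun p hp => hf _ (hT ▸ mem_support_tableauWeight.2 ⟨p, hp, rfl⟩)

theorem exists_strip_of_mem_ssdts {ν : YoungDiagram} {f : ℕ →₀ ℕ} {a b : ℕ}
    (hf : ∀ c ∈ f.support, c < a) {T : Finset (Finset (ℕ × ℕ) × ℕ)}
    (hT : T ∈ ssdts ν (Finsupp.single a b + f)) :
    ∃ μ ≤ ν, ∃ T' ∈ ssdts μ f, ∃ D, IsStripTiling μ ν D ∧
      T = T' ∪ D.image fun d => (d, a) := by
  classical
  rw [mem_ssdts] at hT
  obtain ⟨hT, hw⟩ := hT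
  have hle : ∀ p ∈ T, p.2 ≤ a := by
    intro p hp
    have h : p.2 ∈ (tableauWeight T).support := mem_support_tableauWeight.2 ⟨p, hp, rfl⟩
    rw [hw] at h
    rcases Finset.mem_union.1 (Finsupp.support_add h) with h | h
    · rw [Finset.mem_singleton.1 (Finsupp.support_single_subset h)]
    · exact (hf _ h).le
  obtain ⟨μ, hμν, hT', hD⟩ := exists_remove_max hT hle
  refine ⟨μ, hμν, _, mem_ssdts.2 ⟨hT', ?_⟩, _, hD, (insert_strip_filter T a).symm⟩
  have hlt : ∀ p ∈ T.filter (fun p => p.2 ≠ a), p.2 < a := by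
    intro p hp
    rw [Finset.mem_filter] at hp
    exact lt_of_le_of_ne (hle p hp.1) hp.2
  have h := tableauWeight_insert_strip
    (D := (T.filter fun p => p.2 = a).image Prod.fst) hlt
  rw [insert_strip_filter, hw] at h
  ext c
  have hc := DFunLike.congr_fun h c
  simp only [Finsupp.add_apply, Finsupp.single_apply] at hc
  by_cases hca : a = c
  · subst hca
    have h1 : f a = 0 := by
      by_contra h0
      exact lt_irrefl _ (hf a (Finsupp.mem_support_iff.2 h0))
    have h2 : tableauWeight (T.filter fun p => p.2 ≠ a) a = 0 := by
      by_contra h0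
      obtain ⟨p, hp, hpa⟩ := mem_support_tableauWeight.1 (Finsupp.mem_support_iff.2 h0)
      exact (hlt p hp).ne hpa
    rw [h1, h2]
  · simp only [hca, if_false] at hc
    omega

theorem insert_strip_mem_ssdts {μ ν : YoungDiagram} {f : ℕ →₀ ℕ} {a b : ℕ}
    (hf : ∀ c ∈ f.support, c < a) {T : Finset (Finset (ℕ × ℕ) × ℕ)} (hT : T ∈ ssdts μ f)
    (hμν : μ ≤ ν) {D : Finset (Finset (ℕ × ℕ))} (hD : IsStripTiling μ ν D)
    (hcorner : ({(0, 0), (1, 0)} : Finset (ℕ × ℕ)) ∈ D → a ≠ 0)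
    (hν : ν.card = 2 * (f.degree + b)) :
    (T ∪ D.image fun d => (d, a)) ∈ ssdts ν (Finsupp.single a b + f) := by
  rw [mem_ssdts] at hT ⊢
  have hlt := label_lt_of_weight hT.2 hf
  have h := hT.1.insert_strip hμν hD hlt hcorner
  refine ⟨h, ?_⟩
  have hw := tableauWeight_insert_strip (D := D) hlt
  have hc := h.card_eq
  rw [hν, ← degree_tableauWeight, hw, map_add, Finsupp.degree_single, hT.2] at hc
  rw [hw, hT.2, add_comm, show D.card = b by omega]

theorem le_of_stripRows {μ ν : YoungDiagram} (h : StripRows μ.rowLen ν.rowLen) : μ ≤ ν := by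
  rintro ⟨i, j⟩ hc
  have := h.1 i
  have := YoungDiagram.mem_iff_lt_rowLen.1 hc
  exact YoungDiagram.mem_iff_lt_rowLen.2 (by omega)

-- A tableau is determined by its part with labels below a, because the remaining strip has exactly
-- one tiling. As a ≠ 0, the corner condition does not restrict that strip.
open Classical in
theorem card_ssdts_single_add {f : ℕ →₀ ℕ} {a b : ℕ} (ha : a ≠ 0)
    (hf : ∀ c ∈ f.support, c < a) {q : HookPair}
    (hq : hookSize q.1 + hookSize q.2 = f.degree + b) :
    (ssdts (quotientShape q) (Finsupp.single a b + f)).card =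
      ∑ p ∈ (hookPairs f.degree).filter (fun p => HookStrip p.1 q.1 ∧ HookStrip p.2 q.2),
        (ssdts (quotientShape p) f).card := by
  have hcard : (quotientShape q).card = 2 * (f.degree + b) := by rw [card_quotientShape, hq]
  have hstrip : ∀ p : HookPair, HookStrip p.1 q.1 ∧ HookStrip p.2 q.2 →
      StripRows (quotientShape p).rowLen (quotientShape q).rowLen :=
    fun p hp => stripRows_quotientShape_iff.2 ⟨p, rfl, hp⟩
  -- The implication inside the existential makes D a total function of p, equal to the junk value ∅
  -- where there is no strip.
  have hex : ∀ p : HookPair, ∃ D, (HookStrip p.1 q.1 ∧ HookStrip p.2 q.2) →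
      IsStripTiling (quotientShape p) (quotientShape q) D := by
    intro p
    by_cases hp : HookStrip p.1 q.1 ∧ HookStrip p.2 q.2
    · obtain ⟨D, hD⟩ := exists_isStripTiling (hstrip p hp)
      exact ⟨D, fun _ => hD⟩
    · exact ⟨∅, fun h => absurd h hp⟩
  choose D hD using hex
  rw [← Finset.card_sigma]
  symm
  refine Finset.card_bij (fun x _ => x.2 ∪ (D x.1).image fun d => (d, a)) ?_ ?_ ?_
  · rintro ⟨p, T⟩ hx
    rw [Finset.mem_sigma, Finset.mem_filter] at hx
    exact insert_strip_mem_ssdts hf hx.2 (le_of_stripRows (hstrip p hx.1.2)) (hD p hx.1.2)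
      (fun _ => ha) hcard
  · rintro ⟨p, T⟩ hx ⟨p', T'⟩ hx' h
    rw [Finset.mem_sigma, Finset.mem_filter] at hx hx'
    have hT := mem_ssdts.1 hx.2
    have hT' := mem_ssdts.1 hx'.2
    have e := congrArg (Finset.filter fun r => r.2 ≠ a) h
    simp only [filter_insert_strip (label_lt_of_weight hT.2 hf),
      filter_insert_strip (label_lt_of_weight hT'.2 hf)] at e
    subst e
    -- The old tableau T covers exactly the cells of its shape, and the shape determines the pair of
    -- hooks.
    have : p = p' := quotientShape_injective (YoungDiagram.ext (by
      rw [hT.1.cells_eq, hT'.1.cells_eq]))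
    rw [this]
  · intro T hT
    obtain ⟨μ, hμν, T', hT', D', hD', rfl⟩ := exists_strip_of_mem_ssdts hf hT
    obtain ⟨p, rfl, hp⟩ := stripRows_quotientShape_iff.1 (hD'.stripRows hμν)
    refine ⟨⟨p, T'⟩, ?_, by rw [(hD p hp).eq hD']⟩
    rw [Finset.mem_sigma, Finset.mem_filter, mem_hookPairs]
    have := card_of_mem_ssdts hT'
    rw [card_quotientShape] at this
    exact ⟨⟨by dsimp only; omega, hp⟩, hT'⟩

theorem quotientShape_none : quotientShape (none, none) = ⊥ := by
  refine youngDiagram_ext ?_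
  rw [rowLen_quotientShape]
  funext i
  have h : (⊥ : YoungDiagram).rowLen i = 0 := by
    by_contra h
    exact YoungDiagram.notMem_bot (i, 0) (YoungDiagram.mem_iff_lt_rowLen.2 (by omega))
  rw [h]
  simp [quotientRows, doubleHookRows]

theorem ssdts_bot_zero : ssdts ⊥ 0 = {∅} := by
  ext T
  rw [mem_ssdts, Finset.mem_singleton]
  constructor
  · rintro ⟨h, -⟩
    have := h.card_eq
    rw [← Finset.card_eq_zero]
    have h0 : (⊥ : YoungDiagram).card = 0 := by simp [YoungDiagram.card]
    omega
  · rintro rfl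
    exact ⟨⟨by simp, by simp, by simp, by simp, by simp⟩, by simp [tableauWeight]⟩

theorem eq_bot_of_mem_ssdts_zero {μ : YoungDiagram} {T : Finset (Finset (ℕ × ℕ) × ℕ)}
    (h : T ∈ ssdts μ 0) : μ = ⊥ := by
  have := card_of_mem_ssdts h
  refine YoungDiagram.ext ?_
  rw [YoungDiagram.cells_bot, ← Finset.card_eq_zero]
  simpa using this

/-- With all labels 0 the whole shape is a strip over the empty shape, so both hooks are rows. If
the first is nonempty, the shape has the cell (1, 0) and its corner domino is vertical with label 0,
which is forbidden. This leaves the single row of length 2b. -/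
theorem card_ssdts_single_zero {b : ℕ} (hb : b ≠ 0) {q : HookPair}
    (hq : hookSize q.1 + hookSize q.2 = b) :
    (ssdts (quotientShape q) (Finsupp.single 0 b)).card =
      if q = (none, some (b - 1, 0)) then 1 else 0 := by
  have hcard : (quotientShape q).card = 2 * ((0 : ℕ →₀ ℕ).degree + b) := by
    rw [card_quotientShape, hq]
    simp
  rw [← add_zero (Finsupp.single 0 b)]
  split_ifs with h
  · have hs : StripRows (quotientShape (none, none)).rowLen (quotientShape q).rowLen := by
      refine stripRows_quotientShape_iff.2 ⟨(none, none), rfl, ?_⟩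
      rw [h]
      exact ⟨trivial, rfl⟩
    obtain ⟨D, hD⟩ := exists_isStripTiling hs
    rw [Finset.card_eq_one]
    refine ⟨∅ ∪ D.image fun d => (d, 0), ?_⟩
    ext T
    rw [Finset.mem_singleton]
    constructor
    · intro hT
      obtain ⟨μ, hμν, T', hT', D', hD', rfl⟩ := exists_strip_of_mem_ssdts (by simp) hT
      obtain rfl := eq_bot_of_mem_ssdts_zero hT'
      rw [ssdts_bot_zero, Finset.mem_singleton] at hT'
      rw [← quotientShape_none] at hD'
      rw [hT', hD.eq hD']
    · rintro rfl
      refine insert_strip_mem_ssdts (μ := quotientShape (none, none)) (by simp) ?_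
        (le_of_stripRows hs) hD ?_ hcard
      · rw [quotientShape_none, ssdts_bot_zero, Finset.mem_singleton]
      · intro hc
        have := ((hD.domino _ hc).2 (1, 0) (by simp)).1
        rw [mem_quotientShape, h] at this
        simp [quotientRows, doubleHookRows] at this
  · rw [Finset.card_eq_zero, Finset.eq_empty_iff_forall_notMem]
    intro T hT
    obtain ⟨μ, hμν, T', hT', D, hD, rfl⟩ := exists_strip_of_mem_ssdts (by simp) hT
    obtain rfl := eq_bot_of_mem_ssdts_zero hT'
    obtain ⟨p, hp, h1, h2⟩ := stripRows_quotientShape_iff.1 (hD.stripRows hμν)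
    rw [← quotientShape_none] at hp
    obtain rfl := quotientShape_injective hp
    rw [ssdts_bot_zero, Finset.mem_singleton] at hT'
    have hno : (1, 0) ∉ quotientShape q := by
      intro h10
      have hm : ∀ c, c ∉ (⊥ : YoungDiagram) := YoungDiagram.notMem_bot
      have h00 := (quotientShape q).up_left_mem (Nat.zero_le 1) le_rfl h10
      obtain ⟨d, hd, hc⟩ := hD.cover _ h00 (hm _)
      have hc' := hD.mem_of_mem_col hd hc h10 (hm _)
      have hdc : d = {(0, 0), (1, 0)} := by
        obtain ⟨i, j, rfl | rfl⟩ := (hD.domino d hd).1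
        · simp at hc hc'
          omega
        · have : i = 0 ∧ j = 0 := by
            simp at hc hc'
            omega
          rw [this.1, this.2]
      refine (mem_ssdts.1 hT).1.corner 0 ?_ rfl
      rw [← hdc]
      exact Finset.mem_union_right _ (Finset.mem_image_of_mem _ hd)
    rw [mem_quotientShape] at hno
    rcases q with ⟨_ | ⟨c, d⟩, _ | ⟨c', d'⟩⟩ <;>
      simp [quotientRows, doubleHookRows, hookSize, HookStrip] at hno h1 h2 hq h <;> omega

/-- Twice the coefficient of a monomial in the quasisymmetric function of the left-unimodal
signed permutations. -/
def unimodalCoeff (m : ℕ →₀ ℕ) : ℕ := m.prod fun a k => if a = 0 then 2 else 4 * k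

theorem unimodalCoeff_single_add {f : ℕ →₀ ℕ} {a b : ℕ} (hf : a ∉ f.support) (hb : b ≠ 0) :
    unimodalCoeff (Finsupp.single a b + f) = (if a = 0 then 2 else 4 * b) * unimodalCoeff f := by
  classical
  rw [unimodalCoeff, Finsupp.prod_add_index_of_disjoint, Finsupp.prod, Finsupp.support_single _ hb,
    Finset.prod_singleton, Finsupp.single_eq_same, unimodalCoeff]
  rw [Finset.disjoint_left]
  intro c hc
  rw [Finset.mem_singleton.1 (Finsupp.support_single_subset hc)]
  exact hf

/-- Induction on the largest label a. Interchanging the sums over the smaller shape p and the larger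
shape q turns the inner sum into a weighted strip count, a factor 4b independent of p; the base
label 0 contributes the weight 2 of a single row. -/
theorem sum_hookWeight_mul_card_ssdts (m : ℕ →₀ ℕ) :
    ∑ q ∈ hookPairs m.degree, hookWeight q.1 * hookWeight q.2 *
      (ssdts (quotientShape q) m).card = unimodalCoeff m := by
  classical
  induction m using Finsupp.induction_on_max with
  | zero =>
    have : hookPairs (0 : ℕ →₀ ℕ).degree = {(none, none)} := by
      simp [hookPairs, hooks]
    rw [this, Finset.sum_singleton, quotientShape_none, ssdts_bot_zero]
    rfl
  | single_add a b f hf hb ih =>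
    rw [unimodalCoeff_single_add (fun h => lt_irrefl _ (hf a h)) hb, map_add, Finsupp.degree_single]
    by_cases ha : a = 0
    · subst ha
      have hf0 : f = 0 := by
        rw [← Finsupp.support_eq_empty, Finset.eq_empty_iff_forall_notMem]
        exact fun c hc => Nat.not_lt_zero _ (hf c hc)
      subst hf0
      rw [map_zero, add_zero, add_zero, Finset.sum_congr rfl fun q hq => by
        rw [card_ssdts_single_zero hb (mem_hookPairs.1 hq)]]
      simp only [mul_ite, mul_one, mul_zero]
      rw [Finset.sum_ite_eq' , if_pos]
      · rfl
      · rw [mem_hookPairs]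
        simp [hookSize]
        omega
    · rw [if_neg ha, ← ih, Finset.sum_congr rfl fun q hq => by
        rw [card_ssdts_single_add ha hf (by rw [mem_hookPairs.1 hq, add_comm]), Finset.mul_sum,
          Finset.sum_filter], Finset.sum_comm, Finset.mul_sum]
      refine Finset.sum_congr rfl fun p hp => ?_
      rw [mem_hookPairs] at hp
      have h := sum_hookPairs_strip p (Nat.pos_of_ne_zero hb)
      rw [hp, add_comm, Finset.sum_filter] at h
      rw [← mul_assoc, ← h, Finset.sum_mul]
      refine Finset.sum_congr rfl fun q _ => ?_
      split_ifs <;> simp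

end TypeB

/-! ### Counting compatible mark sequences -/

namespace TypeB

/-- A letter of a marked sign sequence: the first entry says whether the letter is negative, the
second whether it is placed to the left of the valley. -/
abbrev Mark := Bool × Bool

/-- Marks of consecutive values of a left-unimodal signed permutation without descent. -/
def Compat (s t : Mark) : Prop :=
  if s.1 then (s.2 → ¬ t.1) else (¬ t.1 ∧ ¬ t.2)

instance : DecidableRel Compat := fun s t => by unfold Compat; infer_instance

/-- The number of compatible mark sequences of length `p` with last entry `t`, all of whose letters
have absolute value `a`. -/
def markVec (a p : ℕ) (t : Mark) : ℕ :=
  if a = 0 then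
    if p = 0 then if t = (true, true) then 1 else 0
    else if p = 1 then if t.1 then 0 else 1
    else if t = (false, false) then 2 else 0
  else if t.1 then 1 else if t.2 then min p 2 else if p = 1 then 1 else 4 * p - 4

theorem sum_mark {f : Mark → ℕ} :
    ∑ s, f s = f (true, true) + f (true, false) + f (false, true) + f (false, false) := by
  rw [Fintype.sum_prod_type]
  simp [add_assoc]

/-- One step of the transfer matrix within a run. For a = 0 the value p = 0 is allowed: it stands
for the fixed mark at index 0, where i vanishes. -/
theorem sum_markVec_compat {a p : ℕ} (h : a = 0 ∨ 1 ≤ p) (t : Mark) :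
    (∑ s, if Compat s t then markVec a p s else 0) = markVec a (p + 1) t := by
  rw [sum_mark]
  rcases t with ⟨_ | _, _ | _⟩ <;> simp [Compat, markVec] <;> split_ifs <;> omega

theorem sum_markVec {a p : ℕ} (h : a = 0 ∨ 1 ≤ p) :
    ∑ s, markVec a p s = if p = 0 then 1 else if a = 0 then 2 else 4 * p := by
  rw [sum_mark]
  simp [markVec]
  split_ifs <;> omega

/-- Mark sequences compatible with a sequence of absolute values. -/
def markSeqs (n : ℕ) (i : Fin (n + 1) → ℕ) : Finset (Fin (n + 1) → Mark) :=
  Finset.univ.filter fun s => s 0 = (true, true) ∧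
    ∀ j : Fin n, i j.castSucc = i j.succ → Compat (s j.castSucc) (s j.succ)

/-- The exponent vector of the monomial `x_{i_1} ⋯ x_{i_n}`. -/
noncomputable def content {n : ℕ} (i : Fin (n + 1) → ℕ) : ℕ →₀ ℕ :=
  ∑ j : Fin n, Finsupp.single (i j.succ) 1

theorem content_succ {n : ℕ} (i : Fin (n + 2) → ℕ) :
    content i = content (fun j => i j.castSucc) + Finsupp.single (i (Fin.last _)) 1 := by
  rw [content, Fin.sum_univ_castSucc]
  rfl

theorem mem_support_content {n : ℕ} {i : Fin (n + 1) → ℕ} {a : ℕ} :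
    a ∈ (content i).support ↔ ∃ j : Fin n, i j.succ = a := by
  simp [content, Finsupp.finsetSum_apply, Finsupp.single_apply]

theorem card_markSeqs_succ {n : ℕ} (i : Fin (n + 2) → ℕ) (t : Mark) :
    ((markSeqs (n + 1) i).filter fun s => s (Fin.last _) = t).card =
      ∑ s, if (i (Fin.last n).castSucc = i (Fin.last _) → Compat s t) then
        ((markSeqs n fun j => i j.castSucc).filter fun r => r (Fin.last _) = s).card else 0 := by
  rw [Finset.card_eq_sum_card_fiberwise (f := fun s => s (Fin.last n).castSucc)
    (t := Finset.univ) (by simp)]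
  refine Finset.sum_congr rfl fun s _ => ?_
  have hiff : ∀ r : Fin (n + 2) → Mark, r ∈ markSeqs (n + 1) i ↔
      (fun j => r j.castSucc) ∈ markSeqs n (fun j => i j.castSucc) ∧
      (i (Fin.last n).castSucc = i (Fin.last _) →
        Compat (r (Fin.last n).castSucc) (r (Fin.last _))) := by
    intro r
    simp only [markSeqs, Finset.mem_filter, Finset.mem_univ, true_and, Fin.forall_fin_succ',
      Fin.castSucc_zero, Fin.succ_castSucc, Fin.succ_last, and_assoc]
  split_ifs with h
  · refine Finset.card_bij' (fun r _ => fun j => r j.castSucc) (fun r _ => Fin.snoc r t) ?_ ?_ ?_ ?_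
    · intro r hr
      rw [Finset.mem_filter, Finset.mem_filter, hiff] at hr
      rw [Finset.mem_filter]
      exact ⟨hr.1.1.1, hr.2⟩
    · intro r hr
      rw [Finset.mem_filter] at hr
      rw [Finset.mem_filter, Finset.mem_filter, hiff]
      simp only [Fin.snoc_castSucc, Fin.snoc_last, hr.2]
      exact ⟨⟨⟨hr.1, h⟩, trivial⟩, trivial⟩
    · intro r hr
      rw [Finset.mem_filter, Finset.mem_filter] at hr
      rw [← hr.1.2]
      exact Fin.snoc_init_self r
    · intro r hr
      exact Fin.init_snoc (α := fun _ => Mark) t r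
  · rw [Finset.card_eq_zero, Finset.eq_empty_iff_forall_notMem]
    intro r hr
    rw [Finset.mem_filter, Finset.mem_filter, hiff] at hr
    rw [hr.1.2, hr.2] at hr
    exact h hr.1.1.2

theorem unimodalCoeff_erase {m : ℕ →₀ ℕ} {a : ℕ} (h : a = 0 ∨ 1 ≤ m a) :
    unimodalCoeff (m.erase a) * ∑ s, markVec a (m a) s = unimodalCoeff m := by
  rw [sum_markVec h]
  by_cases hm : m a = 0
  · rw [if_pos hm, mul_one, Finsupp.erase_of_notMem_support (by simpa using hm)]
  · rw [if_neg hm, mul_comm, ← unimodalCoeff_single_add (by simp) hm, Finsupp.single_add_erase]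

/-- Induction along i. Within a run the vector of counts moves by the transfer matrix; when a new
run begins there is no constraint, so the finished run contributes its total and every mark restarts
with count 1. -/
theorem card_markSeqs_last {n : ℕ} (i : Fin (n + 1) → ℕ) (h0 : i 0 = 0) (hi : Monotone i)
    (t : Mark) :
    ((markSeqs n i).filter fun s => s (Fin.last _) = t).card =
      unimodalCoeff ((content i).erase (i (Fin.last _))) *
        markVec (i (Fin.last _)) (content i (i (Fin.last _))) t := by
  induction n generalizing t with
  | zero =>
    have h1 : content i = 0 := by simp [content]
    have h2 : i (Fin.last 0) = 0 := h0
    rw [h1, h2]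
    have : unimodalCoeff (Finsupp.erase 0 0) = 1 := by simp [unimodalCoeff]
    rw [this, one_mul]
    have : ((markSeqs 0 i).filter fun s => s (Fin.last 0) = t) =
        if t = (true, true) then {fun _ => (true, true)} else ∅ := by
      ext s
      simp only [markSeqs, Finset.mem_filter, Finset.mem_univ, true_and]
      split_ifs with ht
      · rw [Finset.mem_singleton, ht]
        constructor
        · rintro ⟨⟨h, -⟩, -⟩
          funext j
          rw [show j = 0 from Fin.ext (by omega), h]
        · rintro rfl
          exact ⟨⟨rfl, fun j => j.elim0⟩, rfl⟩
      · simp only [Finset.notMem_empty, iff_false]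
        rintro ⟨⟨h, -⟩, h'⟩
        exact ht (h'.symm.trans h)
    rw [this]
    rcases t with ⟨_ | _, _ | _⟩ <;> simp [markVec]
  | succ n ih =>
    have hmono : Monotone fun j : Fin (n + 1) => i j.castSucc :=
      hi.comp (Fin.strictMono_castSucc).monotone
    have ih' := ih (fun j => i j.castSucc) h0 hmono
    have hone : i (Fin.last n).castSucc = 0 ∨
        1 ≤ content (fun j => i j.castSucc) (i (Fin.last n).castSucc) := by
      rcases n with _ | n
      · exact Or.inl h0
      · right
        rw [Nat.one_le_iff_ne_zero, ← Finsupp.mem_support_iff, mem_support_content]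
        exact ⟨Fin.last n, rfl⟩
    have hle : i (Fin.last n).castSucc ≤ i (Fin.last (n + 1)) := hi (Fin.le_last _)
    rw [card_markSeqs_succ, content_succ]
    rcases hle.eq_or_lt with hab | hab
    · simp only [hab, true_imp_iff]
      simp only [hab] at ih' hone
      simp only [ih', ← mul_ite_zero, ← Finset.mul_sum]
      rw [sum_markVec_compat hone, Finsupp.add_apply, Finsupp.single_eq_same, Finsupp.erase_add,
        Finsupp.erase_single, add_zero]
    · have hne : i (Fin.last n).castSucc ≠ i (Fin.last (n + 1)) := hab.ne
      simp only [hne, false_imp_iff, if_true, ih', ← Finset.mul_sum]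
      rw [unimodalCoeff_erase hone]
      have hz : content (fun j => i j.castSucc) (i (Fin.last (n + 1))) = 0 := by
        by_contra h
        obtain ⟨j, hj⟩ := mem_support_content.1 (Finsupp.mem_support_iff.2 h)
        have : i j.succ.castSucc ≤ i (Fin.last n).castSucc := hmono (Fin.le_last _)
        omega
      rw [Finsupp.add_apply, hz, Finsupp.single_eq_same, Finsupp.erase_add, Finsupp.erase_single,
        add_zero, Finsupp.erase_of_notMem_support (by simpa using hz)]
      -- The new run has a nonzero value by `hab`, so the special start for the value 0 does not
      -- occur here.
      have : markVec (i (Fin.last (n + 1))) (0 + 1) t = 1 := by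
        rcases t with ⟨_ | _, _ | _⟩ <;> simp [markVec] <;> omega
      rw [this, mul_one]

theorem card_markSeqs {n : ℕ} (i : Fin (n + 1) → ℕ) (h0 : i 0 = 0) (hi : Monotone i) :
    (markSeqs n i).card = unimodalCoeff (content i) := by
  rw [Finset.card_eq_sum_card_fiberwise (f := fun s => s (Fin.last n))
    (t := Finset.univ) (by simp)]
  simp only [card_markSeqs_last i h0 hi, ← Finset.mul_sum]
  apply unimodalCoeff_erase
  rcases n with _ | n
  · exact Or.inl h0
  · right
    rw [Nat.one_le_iff_ne_zero, ← Finsupp.mem_support_iff, mem_support_content]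
    exact ⟨Fin.last n, rfl⟩

end TypeB

/-! ### Signed permutations as absolute values with signs -/

namespace TypeB

section SignedPerm

variable {n : ℕ}

theorem signedVal_of_mem (π : signedPerm n) {x : ℤ} (hx : x ∈ Finset.Icc (-(n : ℤ)) (n : ℤ)) :
    signedVal π x = (π.1 ⟨x, hx⟩ : ℤ) := dif_pos hx

theorem signedVal_mem (π : signedPerm n) {x : ℤ} (hx : x ∈ Finset.Icc (-(n : ℤ)) (n : ℤ)) :
    signedVal π x ∈ Finset.Icc (-(n : ℤ)) (n : ℤ) := by
  rw [signedVal_of_mem π hx]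
  exact (π.1 ⟨x, hx⟩).2

theorem signedVal_inv_signedVal (π : signedPerm n) {x : ℤ}
    (hx : x ∈ Finset.Icc (-(n : ℤ)) (n : ℤ)) : signedVal π⁻¹ (signedVal π x) = x := by
  rw [signedVal_of_mem π⁻¹ (signedVal_mem π hx)]
  have : (⟨signedVal π x, signedVal_mem π hx⟩ : Finset.Icc (-(n : ℤ)) (n : ℤ)) = π.1 ⟨x, hx⟩ :=
    Subtype.ext (signedVal_of_mem π hx)
  rw [this]
  simp

theorem neg_mem_Icc {x : ℤ} (hx : x ∈ Finset.Icc (-(n : ℤ)) (n : ℤ)) :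
    -x ∈ Finset.Icc (-(n : ℤ)) (n : ℤ) := by
  rw [Finset.mem_Icc] at hx ⊢
  omega

theorem signedVal_neg (π : signedPerm n) {x : ℤ} (hx : x ∈ Finset.Icc (-(n : ℤ)) (n : ℤ)) :
    signedVal π (-x) = -signedVal π x := by
  rw [signedVal_of_mem π hx, signedVal_of_mem π (neg_mem_Icc hx)]
  exact π.2 ⟨x, hx⟩ ⟨-x, neg_mem_Icc hx⟩ rfl

theorem signedVal_zero (π : signedPerm n) : signedVal π 0 = 0 := by
  have h := signedVal_neg π (x := 0) (by simp)
  rw [neg_zero] at h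
  omega

theorem signedVal_injOn (π : signedPerm n) {x y : ℤ} (hx : x ∈ Finset.Icc (-(n : ℤ)) (n : ℤ))
    (hy : y ∈ Finset.Icc (-(n : ℤ)) (n : ℤ)) (h : signedVal π x = signedVal π y) : x = y := by
  rw [← signedVal_inv_signedVal π hx, h, signedVal_inv_signedVal π hy]

theorem succ_mem_Icc (k : Fin n) : ((k : ℕ) : ℤ) + 1 ∈ Finset.Icc (-(n : ℤ)) (n : ℤ) := by
  rw [Finset.mem_Icc]
  omega

theorem signedVal_succ_ne_zero (π : signedPerm n) (k : Fin n) :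
    signedVal π ((k : ℕ) + 1) ≠ 0 := by
  intro h
  have := signedVal_injOn π (succ_mem_Icc k) (y := 0) (by simp) (by rw [h, signedVal_zero])
  omega

theorem natAbs_signedVal_lt (π : signedPerm n) (k : Fin n) :
    (signedVal π ((k : ℕ) + 1)).natAbs - 1 < n := by
  have h := signedVal_mem π (succ_mem_Icc k)
  have := signedVal_succ_ne_zero π k
  rw [Finset.mem_Icc] at h
  omega

theorem natAbs_signedVal_inv (π : signedPerm n) (k : Fin n) :
    (signedVal π⁻¹ ((((signedVal π ((k : ℕ) + 1)).natAbs - 1 : ℕ) : ℤ) + 1)).natAbs - 1 = k := by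
  have h0 := signedVal_succ_ne_zero π k
  have h1 := signedVal_inv_signedVal π (succ_mem_Icc k)
  have hm := signedVal_mem π (succ_mem_Icc k)
  rcases lt_or_gt_of_ne h0 with h | h
  · have e : ((((signedVal π ((k : ℕ) + 1)).natAbs - 1 : ℕ) : ℤ) + 1) =
        -signedVal π ((k : ℕ) + 1) := by omega
    rw [e, signedVal_neg _ hm, h1]
    omega
  · have e : ((((signedVal π ((k : ℕ) + 1)).natAbs - 1 : ℕ) : ℤ) + 1) =
        signedVal π ((k : ℕ) + 1) := by omega
    rw [e, h1]
    omega

/-- The permutation of absolute values underlying a signed permutation. -/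
noncomputable def absPerm (π : signedPerm n) : Equiv.Perm (Fin n) where
  toFun k := ⟨(signedVal π ((k : ℕ) + 1)).natAbs - 1, natAbs_signedVal_lt π k⟩
  invFun k := ⟨(signedVal π⁻¹ ((k : ℕ) + 1)).natAbs - 1, natAbs_signedVal_lt π⁻¹ k⟩
  left_inv k := Fin.ext (natAbs_signedVal_inv π k)
  right_inv k := Fin.ext (by simpa using natAbs_signedVal_inv π⁻¹ k)

/-- The signs of the values of a signed permutation: `true` for the negative ones. -/
noncomputable def isNeg (π : signedPerm n) (k : Fin n) : Bool :=
  decide (signedVal π ((k : ℕ) + 1) < 0)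

/-- The integer `k + 1`, negated if `b` is true. -/
def signedSucc (b : Bool) (k : ℕ) : ℤ := if b then -((k : ℤ) + 1) else k + 1

theorem signedVal_succ (π : signedPerm n) (k : Fin n) :
    signedVal π ((k : ℕ) + 1) = signedSucc (isNeg π k) (absPerm π k) := by
  have h0 := signedVal_succ_ne_zero π k
  simp only [signedSucc, isNeg, absPerm, Equiv.coe_fn_mk, decide_eq_true_eq]
  split_ifs <;> omega

theorem signedVal_inv_succ (π : signedPerm n) (k : Fin n) :
    signedVal π⁻¹ ((absPerm π k : ℕ) + 1) = signedSucc (isNeg π k) k := by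
  have h1 := signedVal_inv_signedVal π (succ_mem_Icc k)
  rw [signedVal_succ] at h1
  simp only [signedSucc] at h1 ⊢
  split_ifs at h1 ⊢
  · rw [signedVal_neg _ (succ_mem_Icc _)] at h1
    omega
  · exact h1

theorem signedPerm_ext {π ρ : signedPerm n} (h : absPerm π = absPerm ρ) (h' : isNeg π = isNeg ρ) :
    π = ρ := by
  have key : ∀ k : Fin n, signedVal π ((k : ℕ) + 1) = signedVal ρ ((k : ℕ) + 1) := by
    intro k
    rw [signedVal_succ, signedVal_succ, h, h']
  apply Subtype.ext
  ext ⟨x, hx⟩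
  rw [← signedVal_of_mem π hx, ← signedVal_of_mem ρ hx]
  have hx' := Finset.mem_Icc.1 hx
  rcases lt_trichotomy x 0 with h0 | rfl | h0
  · have := key ⟨(-x - 1).toNat, by omega⟩
    rw [show (((-x - 1).toNat : ℕ) : ℤ) + 1 = -x by omega, signedVal_neg π hx,
      signedVal_neg ρ hx] at this
    omega
  · rw [signedVal_zero, signedVal_zero]
  · have := key ⟨(x - 1).toNat, by omega⟩
    rwa [show (((x - 1).toNat : ℕ) : ℤ) + 1 = x by omega] at this

/-- The prescribed values on 1, …, n are extended to an odd function `g`; it preserves the interval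
and is injective there, hence bijective. -/
theorem exists_signedPerm (τ : Equiv.Perm (Fin n)) (ε : Fin n → Bool) :
    ∃ π : signedPerm n, absPerm π = τ ∧ isNeg π = ε := by
  -- The condition k ≠ 0 is needed because 0 - 1 = 0 in ℕ.
  let A : ℕ → ℤ := fun k => if h : k - 1 < n ∧ k ≠ 0 then
    signedSucc (ε ⟨k - 1, h.1⟩) (τ ⟨k - 1, h.1⟩) else 0
  let g : ℤ → ℤ := fun x => x.sign * A x.natAbs
  have hA : ∀ k : Fin n, A (k + 1) = signedSucc (ε k) (τ k) := by
    intro k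
    have : (k : ℕ) + 1 - 1 < n ∧ (k : ℕ) + 1 ≠ 0 := by omega
    simp only [A, dif_pos this]
    rfl
  have hpos : ∀ x : ℤ, 0 < x → x ≤ n → ∃ k : Fin n, x = (k : ℕ) + 1 ∧
      g x = signedSucc (ε k) (τ k) := by
    intro x h0 h1
    refine ⟨⟨(x - 1).toNat, by omega⟩, by simp; omega, ?_⟩
    rw [← hA]
    simp only [g, Int.sign_eq_one_of_pos h0, one_mul]
    congr 1
    omega
  have hodd : ∀ x, g (-x) = -g x := by
    intro x
    simp [g]
  have h0 : g 0 = 0 := by simp [g]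
  have habs : ∀ (b : Bool) (k : ℕ), (signedSucc b k).natAbs = k + 1 := by
    intro b k
    simp only [signedSucc]
    split_ifs <;> omega
  have hmem : ∀ x ∈ Finset.Icc (-(n : ℤ)) n, g x ∈ Finset.Icc (-(n : ℤ)) n := by
    have hp : ∀ x : ℤ, 0 < x → x ≤ n → g x ∈ Finset.Icc (-(n : ℤ)) n := by
      intro x hx hxn
      obtain ⟨k, -, hk⟩ := hpos x hx hxn
      have := habs (ε k) (τ k)
      have := (τ k).2
      rw [Finset.mem_Icc, hk]
      omega
    intro x hx
    rw [Finset.mem_Icc] at hx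
    rcases lt_trichotomy x 0 with h | rfl | h
    · have := neg_mem_Icc (hp (-x) (by omega) (by omega))
      rwa [hodd, neg_neg] at this
    · simp [h0]
    · exact hp x h hx.2
  have hinjpos : ∀ x y : ℤ, 0 < x → x ≤ n → 0 < y → y ≤ n → (g x).natAbs = (g y).natAbs →
      x = y := by
    intro x y hx hxn hy hyn h
    obtain ⟨k, hk, hgk⟩ := hpos x hx hxn
    obtain ⟨l, hl, hgl⟩ := hpos y hy hyn
    rw [hgk, hgl, habs, habs] at h
    have : k = l := τ.injective (Fin.ext (by omega))
    rw [hk, hl, this]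
  have hne : ∀ x : ℤ, 0 < x → x ≤ n → g x ≠ 0 := by
    intro x hx hxn h
    obtain ⟨k, hk, hgk⟩ := hpos x hx hxn
    have := habs (ε k) (τ k)
    rw [← hgk, h] at this
    simp at this
  have hinj : ∀ x ∈ Finset.Icc (-(n : ℤ)) n, ∀ y ∈ Finset.Icc (-(n : ℤ)) n, g x = g y → x = y := by
    intro x hx y hy h
    rw [Finset.mem_Icc] at hx hy
    rcases lt_trichotomy x 0 with hx0 | rfl | hx0 <;> rcases lt_trichotomy y 0 with hy0 | rfl | hy0
    · have := hinjpos (-x) (-y) (by omega) (by omega) (by omega) (by omega) (by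
        rw [hodd, hodd, h])
      omega
    · exact absurd (by rw [hodd, h, h0, neg_zero]) (hne (-x) (by omega) (by omega))
    · have e := hinjpos (-x) y (by omega) (by omega) (by omega) (by omega) (by
        rw [hodd, h, Int.natAbs_neg])
      have := hne y (by omega) (by omega)
      rw [← e, hodd] at h this
      omega
    · exact absurd (by rw [hodd, ← h, h0, neg_zero]) (hne (-y) (by omega) (by omega))
    · rfl
    · exact absurd (by rw [← h, h0]) (hne y (by omega) (by omega))
    · have e := hinjpos x (-y) (by omega) (by omega) (by omega) (by omega) (by
        rw [hodd, h, Int.natAbs_neg])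
      have := hne x (by omega) (by omega)
      rw [e, hodd] at h this
      omega
    · exact absurd (by rw [h, h0]) (hne x (by omega) (by omega))
    · exact hinjpos x y hx0 hx.2 hy0 hy.2 (by rw [h])
  let G : Finset.Icc (-(n : ℤ)) (n : ℤ) → Finset.Icc (-(n : ℤ)) (n : ℤ) :=
    fun x => ⟨g x, hmem x x.2⟩
  have hG : Function.Injective G := fun x y h =>
    Subtype.ext (hinj x x.2 y y.2 (congrArg Subtype.val h))
  let π : signedPerm n := ⟨Equiv.ofBijective G (Finite.injective_iff_bijective.1 hG), by
    intro i j hij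
    change g j = -g i
    rw [hij, hodd]⟩
  have hπ : ∀ k : Fin n, signedVal π ((k : ℕ) + 1) = signedSucc (ε k) (τ k) := by
    intro k
    rw [signedVal_of_mem π (succ_mem_Icc k)]
    change g ((k : ℕ) + 1) = _
    obtain ⟨l, hl, hgl⟩ := hpos ((k : ℕ) + 1) (by omega) (by omega)
    have : k = l := Fin.ext (by omega)
    rw [hgl, this]
  refine ⟨π, ?_, ?_⟩
  · ext k
    simp only [absPerm, Equiv.coe_fn_mk, hπ, habs]
    omega
  · funext k
    simp only [isNeg, hπ, signedSucc]
    cases ε k <;> simp <;> omega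

end SignedPerm

end TypeB

/-! ### Left-unimodal signed permutations as mark sequences -/

namespace TypeB

section Unimodal

variable {n : ℕ}

/-- The word `π⁻¹(1) ⋯ π⁻¹(n)` decreases on its first `l` letters and increases on the others. -/
def IsUnimodalAt (π : signedPerm n) (l : ℕ) : Prop :=
  l ≤ n ∧ (∀ k : ℕ, 1 ≤ k → k < l → signedVal π⁻¹ (k : ℤ) > signedVal π⁻¹ ((k : ℤ) + 1)) ∧
    ∀ k : ℕ, l < k → k < n → signedVal π⁻¹ (k : ℤ) < signedVal π⁻¹ ((k : ℤ) + 1)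

/-- The signs of the values of `π`, and whether their absolute values are at most `l`. -/
noncomputable def markOf (π : signedPerm n) (l : ℕ) (k : Fin n) : Mark :=
  (isNeg π k, decide ((absPerm π k : ℕ) < l))

/-- Sorting the positions by this key yields a unimodal word with the given marks. -/
def markKey (s : Fin n → Mark) (k : Fin n) : ℤ :=
  -- Letters left of the cut are to be sorted decreasingly, hence the sign change. The shift by 2n +
  -- 2 puts their keys below -(n + 1), and so before all the others, whose keys are at least -n.
  if (s k).2 then -signedSucc (s k).1 k - (2 * n + 2) else signedSucc (s k).1 k

theorem signedSucc_bounds (b : Bool) (k : Fin n) :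
    -(n : ℤ) ≤ signedSucc b k ∧ signedSucc b k ≤ n := by
  have := k.2
  simp only [signedSucc]
  split_ifs <;> omega

theorem signedVal_inv_eq (π : signedPerm n) (p : Fin n) :
    signedVal π⁻¹ ((p : ℕ) + 1) =
      signedSucc (isNeg π ((absPerm π).symm p)) ((absPerm π).symm p : Fin n) := by
  rw [← signedVal_inv_succ, Equiv.apply_symm_apply]

theorem markKey_markOf (π : signedPerm n) (l : ℕ) (p : Fin n) :
    markKey (markOf π l) ((absPerm π).symm p) =
      if (p : ℕ) < l then -signedVal π⁻¹ ((p : ℕ) + 1) - (2 * n + 2)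
      else signedVal π⁻¹ ((p : ℕ) + 1) := by
  simp [markKey, markOf, signedVal_inv_eq]

/-- The comparison across the cut holds automatically by the shift in the key, matching the fact
that unimodality at l does not restrict the letters l and l + 1. -/
theorem isUnimodalAt_iff (π : signedPerm n) (l : ℕ) :
    IsUnimodalAt π l ↔ l ≤ n ∧ StrictMono (markKey (markOf π l) ∘ (absPerm π).symm) := by
  refine and_congr_right fun hl => ?_
  rcases n with _ | n
  · exact ⟨fun _ x => x.elim0, fun _ => ⟨fun k => by omega, fun k => by omega⟩⟩
  rw [Fin.strictMono_iff_lt_succ]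
  have hb := fun k : Fin (n + 1) => signedSucc_bounds (isNeg π ((absPerm π).symm k))
    ((absPerm π).symm k)
  simp only [← signedVal_inv_eq] at hb
  constructor
  · rintro ⟨h1, h2⟩ k
    have hb1 := hb k.castSucc
    have hb2 := hb k.succ
    rw [Function.comp_apply, Function.comp_apply, markKey_markOf, markKey_markOf]
    have e1 := h1 (k + 1) (by omega)
    have e2 := h2 (k + 1)
    simp only [Fin.val_castSucc, Fin.val_succ, Nat.cast_add, Nat.cast_one] at *
    split_ifs <;> omega
  · intro h
    refine ⟨fun k hk hkl => ?_, fun k hk hkn => ?_⟩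
    · obtain ⟨k, rfl⟩ : ∃ j, k = j + 1 := ⟨k - 1, by omega⟩
      have := h ⟨k, by omega⟩
      rw [Function.comp_apply, Function.comp_apply, markKey_markOf, markKey_markOf] at this
      simp only [Fin.castSucc_mk, Fin.succ_mk, Nat.cast_add, Nat.cast_one] at *
      rw [if_pos (by omega), if_pos hkl] at this
      omega
    · obtain ⟨k, rfl⟩ : ∃ j, k = j + 1 := ⟨k - 1, by omega⟩
      have := h ⟨k, by omega⟩
      rw [Function.comp_apply, Function.comp_apply, markKey_markOf, markKey_markOf] at this
      simp only [Fin.castSucc_mk, Fin.succ_mk, Nat.cast_add, Nat.cast_one] at *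
      rw [if_neg (by omega), if_neg (by omega)] at this
      omega

theorem markKey_injective (s : Fin n → Mark) : Function.Injective (markKey s) := by
  intro k k' h
  have h1 := signedSucc_bounds (s k).1 k
  have h2 := signedSucc_bounds (s k').1 k'
  simp only [markKey, signedSucc] at *
  apply Fin.ext
  split_ifs at * <;> omega

theorem absPerm_lt_iff {π : signedPerm n} {l : ℕ} (h : IsUnimodalAt π l) (k k' : Fin n) :
    absPerm π k < absPerm π k' ↔ markKey (markOf π l) k < markKey (markOf π l) k' := by
  rw [← ((isUnimodalAt_iff π l).1 h).2.lt_iff_lt]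
  simp

/-- The virtual value π(0) = 0 acts like a negative value left of the cut: it only forbids a
negative successor. -/
theorem notMem_descents_zero (π : signedPerm n) (k : Fin n) (hk : (k : ℕ) = 0) (b : Bool) :
    (0 : ℕ) ∉ descents π ↔ Compat (true, true) (isNeg π k, b) := by
  have hn := k.2
  have h := signedVal_succ π k
  rw [hk] at h
  simp only [Nat.cast_zero, zero_add] at h
  simp only [descents, Finset.mem_filter, Finset.mem_range, Nat.cast_zero, signedVal_zero, zero_add,
    h, Compat, signedSucc]
  rcases isNeg π k <;> simp <;> omega

/-- In the word of π⁻¹ the order is: left positive letters with decreasing absolute value, left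
negative with increasing, right negative with decreasing, right positive with increasing. So for
equal signs the marks decide whether k or k + 1 comes first, which compares |π(k)| with |π(k + 1)|;
for different signs the signs alone decide. -/
theorem notMem_descents_succ {π : signedPerm n} {l : ℕ} (h : IsUnimodalAt π l) (k k' : Fin n)
    (hk : (k' : ℕ) = k + 1) :
    (k' : ℕ) ∉ descents π ↔ Compat (markOf π l k) (markOf π l k') := by
  have hlt := absPerm_lt_iff h k k'
  have hlt' := absPerm_lt_iff h k' k
  have h1 := signedVal_succ π k
  have h2 := signedVal_succ π k'
  have hne : (absPerm π k : ℕ) ≠ absPerm π k' := by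
    intro he
    have := (absPerm π).injective (Fin.ext he)
    rw [this] at hk
    omega
  have hcast : ((k' : ℕ) : ℤ) = (k : ℕ) + 1 := by omega
  rw [← hcast] at h1
  simp only [descents, Finset.mem_filter, Finset.mem_range, k'.2, true_and, h1, h2]
  rw [Fin.lt_def] at hlt hlt'
  have hkn := k.2
  have hkn' := k'.2
  simp only [markKey, markOf, signedSucc, Compat] at *
  clear h1 h2
  by_cases hε : isNeg π k = true <;> by_cases hε' : isNeg π k' = true <;>
    by_cases hx : (absPerm π k : ℕ) < l <;> by_cases hy : (absPerm π k' : ℕ) < l <;>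
    simp [hε, hε', hx, hy] at hlt hlt' ⊢ <;> omega

/-- Any marks are realized by sorting the letters by key; l is the number of letters marked as left.
-/
theorem exists_isUnimodalAt (s : Fin n → Mark) :
    ∃ π : signedPerm n, ∃ l, IsUnimodalAt π l ∧ markOf π l = s := by
  set σ := Tuple.sort (markKey s)
  set l := (Finset.univ.filter fun k => markKey s (σ k) < -((n : ℤ) + 1)).card
  have hmono : Monotone (markKey s ∘ σ) := Tuple.monotone_sort _
  have hl : ∀ p : Fin n, (p : ℕ) < l ↔ (s (σ p)).2 = true := by
    intro p
    have h := Tuple.lt_card_lt_iff_apply_lt_of_monotone (f := markKey s ∘ σ)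
      (a := -((n : ℤ) + 1)) (j := p) hmono
    refine h.trans ?_
    have := signedSucc_bounds (s (σ p)).1 (σ p)
    simp only [Function.comp_apply, markKey]
    cases (s (σ p)).2 <;> simp <;> omega
  obtain ⟨π, hπ, hε⟩ := exists_signedPerm σ.symm fun k => (s k).1
  have hmark : markOf π l = s := by
    funext k
    have h := hl (σ.symm k)
    rw [Equiv.apply_symm_apply] at h
    refine Prod.ext ?_ ?_
    · simp [markOf, hε]
    · simp only [markOf, hπ, h]
      simp
  refine ⟨π, l, (isUnimodalAt_iff π l).2 ⟨?_, ?_⟩, hmark⟩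
  · exact (Finset.card_le_univ _).trans (by simp)
  · rw [hmark, hπ]
    exact hmono.strictMono_of_injective ((markKey_injective s).comp σ.injective)

/-- The marks determine the keys, and a strictly increasing arrangement of given keys is unique. -/
theorem isUnimodalAt_unique {π ρ : signedPerm n} {l l' : ℕ} (h : IsUnimodalAt π l)
    (h' : IsUnimodalAt ρ l') (he : markOf π l = markOf ρ l') : π = ρ ∧ l = l' := by
  have h1 := ((isUnimodalAt_iff π l).1 h).2
  have h2 := ((isUnimodalAt_iff ρ l').1 h').2
  rw [← he] at h2
  have hs := Tuple.unique_monotone h1.monotone h2.monotone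
  have hs' : (absPerm π).symm = (absPerm ρ).symm := by
    ext k
    exact congrArg Fin.val (markKey_injective _ (congrFun hs k))
  have hp : absPerm π = absPerm ρ := by
    rw [← Equiv.symm_symm (absPerm π), hs', Equiv.symm_symm]
  have hn : isNeg π = isNeg ρ := by
    funext k
    exact (Prod.ext_iff.1 (congrFun he k)).1
  refine ⟨signedPerm_ext hp hn, ?_⟩
  have hlt : ∀ p : Fin n, (p : ℕ) < l ↔ (p : ℕ) < l' := by
    intro p
    have := (Prod.ext_iff.1 (congrFun he ((absPerm π).symm p))).2
    simp only [markOf, ← hp, Equiv.apply_symm_apply, decide_eq_decide] at this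
    exact this
  have e1 := h.1
  have e2 := h'.1
  by_contra hne
  rcases Nat.lt_or_gt_of_ne hne with hlt' | hlt'
  · have := (hlt ⟨l, by omega⟩).2 hlt'
    simp at this
  · have := (hlt ⟨l', by omega⟩).1 hlt'
    simp at this

/-- `π` has no descent at a position where the sequence `i` does not increase. -/
def IsAdapted (i : Fin (n + 1) → ℕ) (π : signedPerm n) : Prop :=
  ∀ j : Fin n, i j.castSucc = i j.succ → (j : ℕ) ∉ descents π

theorem isAdapted_iff {π : signedPerm n} {l : ℕ} (h : IsUnimodalAt π l) (i : Fin (n + 1) → ℕ) :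
    IsAdapted i π ↔ (Fin.cons (true, true) (markOf π l) : Fin (n + 1) → Mark) ∈ markSeqs n i := by
  simp only [markSeqs, Finset.mem_filter, Finset.mem_univ, Fin.cons_zero, true_and, IsAdapted]
  refine forall_congr' fun j => imp_congr_right fun _ => ?_
  rw [Fin.cons_succ]
  rcases n with _ | n
  · exact j.elim0
  rcases Fin.eq_zero_or_eq_succ j with rfl | ⟨k, rfl⟩
  · rw [Fin.castSucc_zero, Fin.cons_zero]
    exact notMem_descents_zero π 0 rfl _
  · rw [← Fin.succ_castSucc, Fin.cons_succ]
    exact notMem_descents_succ h _ _ (by simp)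

/-- Comparing the letters l and l + 1 shows whether the valley is at l or at l + 1. For l = 0 it is
at 1, which needs n ≥ 1. -/
theorem mem_leftUnimodal_iff (hn : 1 ≤ n) (π : signedPerm n) :
    π ∈ leftUnimodal n ↔ ∃ l, IsUnimodalAt π l := by
  constructor
  · rintro ⟨i, h1, h2, h3, h4⟩
    exact ⟨i, h2, h3, fun k hk => h4 k hk.le⟩
  · rintro ⟨l, h1, h2, h3⟩
    rcases Nat.eq_zero_or_pos l with rfl | hl
    · exact ⟨1, le_rfl, hn, fun j hj hj' => by omega, fun j hj => h3 j hj⟩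
    by_cases hc : l < n ∧ signedVal π⁻¹ (l : ℤ) > signedVal π⁻¹ ((l : ℤ) + 1)
    · refine ⟨l + 1, by omega, by omega, fun j hj hjl => ?_, fun j hj => h3 j (by omega)⟩
      rcases Nat.lt_succ_iff_lt_or_eq.1 hjl with h | rfl
      · exact h2 j hj h
      · exact hc.2
    · refine ⟨l, hl, h1, h2, fun j hj hjn => ?_⟩
      rcases hj.eq_or_lt with rfl | h
      · refine lt_of_le_of_ne (not_lt.1 fun h => hc ⟨hjn, h⟩) fun h => ?_
        have := signedVal_injOn π⁻¹ (x := (l : ℤ)) (y := l + 1)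
          (by rw [Finset.mem_Icc]; omega) (by rw [Finset.mem_Icc]; omega) h
        omega
      · exact h3 j h hjn

/-- With the valley at i the cut can be just before or just after it, so l is i - 1 or i. -/
theorem card_isUnimodalAt {π : signedPerm n} (hπ : π ∈ leftUnimodal n)
    [DecidablePred (IsUnimodalAt π)] :
    ((Finset.range (n + 1)).filter (IsUnimodalAt π)).card = 2 := by
  obtain ⟨i, h1, h2, h3, h4⟩ := hπ
  have : (Finset.range (n + 1)).filter (IsUnimodalAt π) = {i - 1, i} := by
    ext l
    rw [Finset.mem_filter, Finset.mem_range, Finset.mem_insert, Finset.mem_singleton]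
    constructor
    · rintro ⟨-, g1, g2, g3⟩
      by_contra hne
      rcases Nat.lt_or_ge i l with hl | hl
      · exact lt_asymm (g2 i h1 hl) (h4 i le_rfl (by omega))
      · exact lt_asymm (h3 (i - 1) (by omega) (by omega)) (g3 (i - 1) (by omega) (by omega))
    · rintro (rfl | rfl)
      · exact ⟨by omega, by omega, fun k hk hk' => h3 k hk (by omega),
          fun k hk hk' => h4 k (by omega) hk'⟩
      · exact ⟨by omega, h2, h3, fun k hk => h4 k hk.le⟩
  rw [this, Finset.card_pair (by omega)]

-- The factor 2 counts the two cuts of each π; pairs of π and a cut correspond bijectively to mark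
-- sequences preceded by the fixed mark at index 0.
open Classical in
theorem two_mul_card_adapted (hn : 1 ≤ n) (i : Fin (n + 1) → ℕ) :
    2 * ((leftUnimodal n).toFinite.toFinset.filter (IsAdapted i)).card = (markSeqs n i).card := by
  have h2 : 2 * ((leftUnimodal n).toFinite.toFinset.filter (IsAdapted i)).card =
      (((leftUnimodal n).toFinite.toFinset.filter (IsAdapted i)).sigma fun π =>
        (Finset.range (n + 1)).filter (IsUnimodalAt π)).card := by
    rw [Finset.card_sigma, Finset.sum_congr rfl fun π hπ => card_isUnimodalAt (π := π) (by
      simpa using (Finset.mem_filter.1 hπ).1), Finset.sum_const, smul_eq_mul, mul_comm]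
  rw [h2]
  refine Finset.card_bij (fun x _ => Fin.cons (true, true) (markOf x.1 x.2)) ?_ ?_ ?_
  · rintro ⟨π, l⟩ h
    simp only [Finset.mem_sigma, Finset.mem_filter] at h
    exact (isAdapted_iff h.2.2 i).1 h.1.2
  · rintro ⟨π, l⟩ h ⟨ρ, l'⟩ h' he
    simp only [Finset.mem_sigma, Finset.mem_filter] at h h'
    obtain ⟨rfl, rfl⟩ := isUnimodalAt_unique h.2.2 h'.2.2 (Fin.cons_right_injective _ he)
    rfl
  · intro s hs
    obtain ⟨π, l, h, hm⟩ := exists_isUnimodalAt (Fin.tail s)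
    have hs0 : s 0 = (true, true) := (Finset.mem_filter.1 hs).2.1
    have he : (Fin.cons (true, true) (markOf π l) : Fin (n + 1) → Mark) = s := by
      rw [hm, ← hs0, Fin.cons_self_tail]
    refine ⟨⟨π, l⟩, ?_, he⟩
    simp only [Finset.mem_sigma, Finset.mem_filter, Finset.mem_range, Set.Finite.mem_toFinset]
    refine ⟨⟨(mem_leftUnimodal_iff hn π).2 ⟨l, h⟩, (isAdapted_iff h i).2 (he ▸ hs)⟩, ?_, h⟩
    have := h.1
    omega

end Unimodal

end TypeB

/-! ### Comparison of coefficients -/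

namespace TypeB

theorem le_last_of_monotone {n : ℕ} {i : Fin (n + 1) → ℕ} (hi : Monotone i) {a : ℕ}
    (ha : a ∈ (content i).support) : a ≤ i (Fin.last n) := by
  obtain ⟨j, rfl⟩ := mem_support_content.1 ha
  exact hi (Fin.le_last _)

theorem last_mem_support_content {n : ℕ} (i : Fin (n + 2) → ℕ) :
    i (Fin.last _) ∈ (content i).support :=
  mem_support_content.2 ⟨Fin.last n, rfl⟩

theorem eq_of_content_eq {n : ℕ} {i j : Fin (n + 1) → ℕ} (hi0 : i 0 = 0) (hj0 : j 0 = 0)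
    (hi : Monotone i) (hj : Monotone j) (h : content i = content j) : i = j := by
  induction n with
  | zero =>
    funext k
    rw [show k = 0 from Fin.ext (by omega), hi0, hj0]
  | succ n ih =>
    have hlast : i (Fin.last _) = j (Fin.last _) :=
      le_antisymm (le_last_of_monotone hj (h ▸ last_mem_support_content i))
        (le_last_of_monotone hi (h ▸ last_mem_support_content j))
    rw [content_succ, content_succ, hlast, add_left_inj] at h
    have := ih (i := fun k => i k.castSucc) (j := fun k => j k.castSucc) hi0 hj0
      (hi.comp Fin.strictMono_castSucc.monotone) (hj.comp Fin.strictMono_castSucc.monotone) h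
    funext k
    refine Fin.lastCases hlast (fun k => ?_) k
    exact congrFun this k

theorem exists_content_eq {n : ℕ} {m : ℕ →₀ ℕ} (hm : m.degree = n) :
    ∃ i : Fin (n + 1) → ℕ, i 0 = 0 ∧ Monotone i ∧ content i = m := by
  induction n generalizing m with
  | zero =>
    refine ⟨fun _ => 0, rfl, monotone_const, ?_⟩
    rw [Finsupp.degree_eq_zero_iff] at hm
    rw [hm]
    simp [content]
  | succ n ih =>
    have hne : m.support.Nonempty := by
      rw [Finsupp.support_nonempty_iff]
      rintro rfl
      simp at hm
    set a := m.support.max' hne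
    have hle : Finsupp.single a 1 ≤ m := by
      rw [Finsupp.single_le_iff, Nat.one_le_iff_ne_zero, ← Finsupp.mem_support_iff]
      exact Finset.max'_mem _ _
    obtain ⟨m', hm'⟩ := exists_add_of_le hle
    obtain ⟨i, h0, hi, hc⟩ := ih (m := m') (by
      rw [hm', map_add, Finsupp.degree_single] at hm
      omega)
    have hlast : i (Fin.last n) ≤ a := by
      rcases n with _ | n
      · rw [show Fin.last 0 = 0 from rfl, h0]
        exact Nat.zero_le _
      · have h := last_mem_support_content i
        rw [hc] at h
        refine Finset.le_max' _ _ ?_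
        rw [Finsupp.mem_support_iff] at h ⊢
        rw [hm', Finsupp.add_apply]
        omega
    refine ⟨Fin.snoc i a, ?_, ?_, ?_⟩
    · rw [← Fin.castSucc_zero, Fin.snoc_castSucc (α := fun _ => ℕ), h0]
    · rw [Fin.monotone_iff_le_succ]
      intro k
      refine Fin.lastCases ?_ (fun k => ?_) k
      · rw [Fin.snoc_castSucc (α := fun _ => ℕ), Fin.succ_last, Fin.snoc_last]
        exact hlast
      · rw [Fin.snoc_castSucc (α := fun _ => ℕ), Fin.succ_castSucc,
          Fin.snoc_castSucc (α := fun _ => ℕ)]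
        exact hi (Fin.castSucc_le_succ k)
    · rw [content_succ, Fin.snoc_last, hm', ← hc, add_comm]
      simp only [Fin.snoc_castSucc (α := fun _ => ℕ)]

theorem degree_content {n : ℕ} (i : Fin (n + 1) → ℕ) : (content i).degree = n := by
  simp [content, map_sum, Finsupp.degree_single]

theorem mem_chowSequences_iff {n : ℕ} {π : signedPerm n} {m : ℕ →₀ ℕ} {i : Fin (n + 1) → ℕ} :
    i ∈ chowSequences n (descents π) m ↔
      i 0 = 0 ∧ Monotone i ∧ IsAdapted i π ∧ content i = m := by
  refine and_congr_right fun _ => and_congr_right fun hi => and_congr_left fun _ =>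
    forall_congr' fun j => ?_
  have := hi (Fin.castSucc_le_succ j)
  constructor
  · intro h heq hj
    exact (h hj).ne heq
  · intro h hj
    exact lt_of_le_of_ne this fun heq => h heq hj

-- A weakly increasing sequence is determined by its monomial, so only i can contribute.
open Classical in
theorem ncard_chowSequences {n : ℕ} (π : signedPerm n) {i : Fin (n + 1) → ℕ} (h0 : i 0 = 0)
    (hi : Monotone i) :
    (chowSequences n (descents π) (content i)).ncard = if IsAdapted i π then 1 else 0 := by
  have h : ∀ j, j ∈ chowSequences n (descents π) (content i) ↔ j = i ∧ IsAdapted i π := by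
    intro j
    rw [mem_chowSequences_iff]
    constructor
    · rintro ⟨hj0, hj, hjπ, hc⟩
      obtain rfl := eq_of_content_eq hj0 h0 hj hi hc
      exact ⟨rfl, hjπ⟩
    · rintro ⟨rfl, hjπ⟩
      exact ⟨h0, hi, hjπ, rfl⟩
  split_ifs with hA
  · rw [Set.ncard_eq_one]
    exact ⟨i, Set.ext fun j => by rw [h, Set.mem_singleton_iff, and_iff_left hA]⟩
  · rw [Set.ncard_eq_zero (chowSequences_finite _ _ _), Set.eq_empty_iff_forall_notMem]
    exact fun j hj => hA ((h j).1 hj).2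

theorem coeff_quasisymm {n : ℕ} (B : Set (signedPerm n)) (m : ℕ →₀ ℕ) :
    MvPowerSeries.coeff m (quasisymm B) =
      ((∑ π ∈ B.toFinite.toFinset, (chowSequences n (descents π) m).ncard : ℕ) : ℂ) := by
  rw [quasisymm, map_sum, Nat.cast_sum]
  rfl

theorem two_mul_quasisymm_leftUnimodal {n : ℕ} (hn : 1 ≤ n) {m : ℕ →₀ ℕ} (hm : m.degree = n) :
    2 * ∑ π ∈ (leftUnimodal n).toFinite.toFinset, (chowSequences n (descents π) m).ncard =
      unimodalCoeff m := by
  classical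
  obtain ⟨i, h0, hi, rfl⟩ := exists_content_eq hm
  rw [← card_markSeqs i h0 hi, ← two_mul_card_adapted hn, Finset.card_filter]
  congr 1
  exact Finset.sum_congr rfl fun π _ => ncard_chowSequences π h0 hi

theorem quasisymm_leftUnimodal_of_degree_ne {n : ℕ} {m : ℕ →₀ ℕ} (hm : m.degree ≠ n)
    (π : signedPerm n) : (chowSequences n (descents π) m).ncard = 0 := by
  rw [Set.ncard_eq_zero (chowSequences_finite _ _ _), Set.eq_empty_iff_forall_notMem]
  intro i hi
  rw [mem_chowSequences_iff] at hi
  exact hm (by rw [← hi.2.2.2, degree_content])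

theorem coeff_dominoFunction (μ : YoungDiagram) (m : ℕ →₀ ℕ) :
    MvPowerSeries.coeff m (dominoFunction μ) = ((ssdts μ m).card : ℂ) := by
  have h : MvPowerSeries.coeff m (dominoFunction μ) =
      (({T | IsSSDT μ T ∧ tableauWeight T = m}.ncard : ℕ) : ℂ) := rfl
  rw [h, ssdts, Set.ncard_eq_toFinset_card _ (ssdt_finite μ m)]

theorem IsSSDT.mem_emptyTwoCore {μ : YoungDiagram} {T : Finset (Finset (ℕ × ℕ) × ℕ)}
    (hT : IsSSDT μ T) : μ ∈ emptyTwoCore T.card := by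
  refine ⟨hT.card_eq, T.image Prod.fst, ?_, ?_⟩
  · intro d hd
    obtain ⟨p, hp, rfl⟩ := Finset.mem_image.1 hd
    exact hT.domino p hp
  · intro c hc
    obtain ⟨p, ⟨hp, hcp⟩, -⟩ := hT.cover c hc
    refine ⟨p.1, ⟨Finset.mem_image_of_mem _ hp, hcp⟩, ?_⟩
    rintro d ⟨hd, hcd⟩
    obtain ⟨q, hq, rfl⟩ := Finset.mem_image.1 hd
    rw [hT.eq_of_mem hq hp hcd hcp]

theorem two_mul_hookWeight_div {p : HookPair} (h : 1 ≤ hookSize p.1 + hookSize p.2) :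
    2 * (hookWeight p.1 * hookWeight p.2 / 2) = hookWeight p.1 * hookWeight p.2 := by
  rcases p with ⟨_ | p, _ | q⟩ <;> simp [hookSize, hookWeight] at h ⊢

open Classical in
/-- The multiplicities of the domino functions in the quasisymmetric function of the left-unimodal
signed permutations. -/
noncomputable def unimodalMult (n : ℕ) : YoungDiagram →₀ ℕ :=
  -- The filter makes the support condition immediate. Shapes it might discard have no tableaux,
  -- hence a zero domino function. The halving below is exact for n ≥ 1, as then some hook is
  -- nonempty.
  ∑ p ∈ (hookPairs n).filter (fun p => quotientShape p ∈ emptyTwoCore n),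
    Finsupp.single (quotientShape p) (hookWeight p.1 * hookWeight p.2 / 2)

theorem mem_emptyTwoCore_of_mem_support {n : ℕ} {μ : YoungDiagram}
    (h : μ ∈ (unimodalMult n).support) : μ ∈ emptyTwoCore n := by
  classical
  rw [Finsupp.mem_support_iff, unimodalMult, Finsupp.finsetSum_apply] at h
  obtain ⟨p, hp, hne⟩ := Finset.exists_ne_zero_of_sum_ne_zero h
  have : quotientShape p = μ := by
    by_contra hpm
    exact hne (Finsupp.single_eq_of_ne' hpm)
  rw [← this]
  exact (Finset.mem_filter.1 hp).2

theorem coeff_sum_unimodalMult (n : ℕ) (m : ℕ →₀ ℕ) :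
    MvPowerSeries.coeff m ((unimodalMult n).sum fun μ k => k • dominoFunction μ) =
      ((∑ p ∈ hookPairs n, hookWeight p.1 * hookWeight p.2 / 2 *
        (ssdts (quotientShape p) m).card : ℕ) : ℂ) := by
  classical
  rw [unimodalMult, ← Finsupp.sum_finsetSum_index (by simp) (by intros; rw [add_smul]), map_sum,
    Finset.sum_filter, Nat.cast_sum]
  refine Finset.sum_congr rfl fun p hp => ?_
  split_ifs with h
  · rw [Finsupp.sum_single_index (by simp), map_nsmul, coeff_dominoFunction]
    simp
  · have : ssdts (quotientShape p) m = ∅ := by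
      rw [Finset.eq_empty_iff_forall_notMem]
      intro T hT
      have h1 := (mem_ssdts.1 hT).1
      have h2 := h1.card_eq
      rw [card_quotientShape, mem_hookPairs.1 hp] at h2
      have h3 := h1.mem_emptyTwoCore
      rw [show T.card = n by omega] at h3
      exact h h3
    rw [this]
    simp

theorem isGPositive_leftUnimodal (n : ℕ) : IsGPositive (leftUnimodal n) := by
  -- For n = 0 no i with 1 ≤ i ≤ n exists, so the set is empty and Q = 0; the doubled formula would
  -- give the odd value 1 there.
  rcases Nat.eq_zero_or_pos n with rfl | hn
  · refine ⟨0, by simp, ?_⟩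
    have : leftUnimodal 0 = ∅ := by
      rw [Set.eq_empty_iff_forall_notMem]
      rintro π ⟨i, h1, h2, -⟩
      omega
    simp [quasisymm, this]
  refine ⟨unimodalMult n, fun μ hμ => mem_emptyTwoCore_of_mem_support hμ, ?_⟩
  ext m
  rw [coeff_quasisymm, coeff_sum_unimodalMult]
  congr 1
  by_cases hm : m.degree = n
  · have h1 := two_mul_quasisymm_leftUnimodal hn hm
    have h2 := sum_hookWeight_mul_card_ssdts m
    rw [hm] at h2
    have h3 : 2 * ∑ p ∈ hookPairs n, hookWeight p.1 * hookWeight p.2 / 2 *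
        (ssdts (quotientShape p) m).card = unimodalCoeff m := by
      rw [← h2, Finset.mul_sum]
      refine Finset.sum_congr rfl fun p hp => ?_
      rw [← mul_assoc, two_mul_hookWeight_div (by rw [mem_hookPairs.1 hp]; exact hn)]
    omega
  · rw [Finset.sum_eq_zero fun π _ => quasisymm_leftUnimodal_of_degree_ne hm π,
      Finset.sum_eq_zero fun p hp => ?_]
    have : ssdts (quotientShape p) m = ∅ := by
      rw [Finset.eq_empty_iff_forall_notMem]
      intro T hT
      have := card_of_mem_ssdts hT
      rw [card_quotientShape, mem_hookPairs.1 hp] at this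
      omega
    rw [this, Finset.card_empty, mul_zero]

/-! ### Inverse descent classes -/

theorem mem_descents_inv_iff {n : ℕ} (π : signedPerm n) {j : ℕ} (hj : j < n) :
    (j ∈ descents π⁻¹ ↔ signedVal π⁻¹ (j : ℤ) > signedVal π⁻¹ ((j : ℤ) + 1)) ∧
      (j ∉ descents π⁻¹ ↔ signedVal π⁻¹ (j : ℤ) < signedVal π⁻¹ ((j : ℤ) + 1)) := by
  have hne : signedVal π⁻¹ (j : ℤ) ≠ signedVal π⁻¹ ((j : ℤ) + 1) := by
    intro h
    have := signedVal_injOn π⁻¹ (x := (j : ℤ)) (y := j + 1)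
      (by rw [Finset.mem_Icc]; omega) (by rw [Finset.mem_Icc]; omega) h
    omega
  simp only [descents, Finset.mem_filter, Finset.mem_range, hj, true_and]
  omega

/-- As π⁻¹ is injective, a position that is not a descent is a strict ascent, so unimodality is a
condition on Des(π⁻¹) alone. Membership of 0 is left free. -/
theorem leftUnimodal_eq_iUnion (n : ℕ) :
    ∃ 𝒥 : Finset (Finset ℕ), (∀ J ∈ 𝒥, J ⊆ Finset.range n) ∧
      leftUnimodal n = ⋃ J ∈ 𝒥, inverseDescentClass n J := by
  classical
  refine ⟨(Finset.range n).powerset.filter fun J => ∃ i : ℕ, 1 ≤ i ∧ i ≤ n ∧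
    (∀ j, 1 ≤ j → j < i → j ∈ J) ∧ ∀ j, i ≤ j → j < n → j ∉ J, fun J hJ => ?_, ?_⟩
  · exact Finset.mem_powerset.1 (Finset.mem_filter.1 hJ).1
  · ext π
    simp only [Set.mem_iUnion, inverseDescentClass, Set.mem_ofPred_eq, exists_prop,
      exists_eq_right', Finset.mem_filter, Finset.mem_powerset]
    have hsub : descents π⁻¹ ⊆ Finset.range n := Finset.filter_subset _ _
    rw [and_iff_right hsub]
    refine exists_congr fun i => and_congr_right fun _ => and_congr_right fun hin =>
      and_congr ?_ ?_
    · refine forall_congr' fun j => imp_congr_right fun _ => forall_congr' fun hj => ?_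
      exact ((mem_descents_inv_iff π (by omega)).1).symm
    · refine forall_congr' fun j => imp_congr_right fun _ => forall_congr' fun hj => ?_
      exact ((mem_descents_inv_iff π hj).2).symm

end TypeB

theorem mainTheorem9 (n : ℕ) :
    (∃ 𝒥 : Finset (Finset ℕ), (∀ J ∈ 𝒥, J ⊆ Finset.range n) ∧
      TypeB.leftUnimodal n = ⋃ J ∈ 𝒥, TypeB.inverseDescentClass n J) ∧
    TypeB.IsGPositive (TypeB.leftUnimodal n) := by
  exact ⟨TypeB.leftUnimodal_eq_iUnion n, TypeB.isGPositive_leftUnimodal n⟩
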